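/- Let $\mathbb F$ be a field. An unmixed $\Sigma\Pi\Sigma\Pi(k)$ circuit of size $s$ in $n$ variables is an expression $C=\sum_{i=1}^k\prod_{j=1}^n f_{ij}(x_j)$ in which every $f_{ij}\in\mathbb F[x_j]$ is a univariate polynomial with at most $s$ monomials; it is of low degree if the polynomial that it computes has total degree at most $n$. A set $\mathcal H\subseteq\mathbb F^n$ is a hitting set for a class of polynomials if every nonzero polynomial $P$ of the class has a point $a\in\mathcal H$ with $P(a)\ne0$. A polynomial mapping $\mathcal G:\mathbb F^q\to\mathbb F^n$ is a generator for a class if $P(\mathcal G)\not\equiv0$ for every nonzero $P$ of the class. Given distinct $c_0,\dots,c_n\in\mathbb F$, let $W_i$ (for $1\le i\le n$) be the polynomial of degree at most $n$ with $W_i(c_j)=1$ for $j\ge i$ and $W_i(c_j)=0$ for $j<i$. Given a polynomial mapping $\mathcal L_m=(\mathcal L_m^1,\dots,\mathcal L_m^n):\mathbb F^q\to\mathbb F^n$, let $\mathcal S_{0,m}=0$ and, for $l\ge1$ and $1\le i\le n$, $$\mathcal S^i_{l,m}(y_1,\dots,y_l,z_1,\dots,z_l)=\mathcal S^i_{l-1,m}(y_1,\dots,y_{l-1},z_1,\dots,z_{l-1})\,W_i(z_l)+\mathcal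 L^i_m(y_l)\,(1-W_i(z_l)),$$ where $y_j\in\mathbb F^q$ and $z_j\in\mathbb F$. The model of computation: programs (finite texts, the same for all fields) over binary trees whose leaves are empty or carry an element of $\mathbb F$, with sequencing, branching and while-loops, where each elementary instruction (building a cell, following a pointer, a constant, a field operation, a test for zero, a query to a black box for a polynomial) takes one unit of time. Theorem. There are programs $\mathsf{Alg}$ and $\mathsf{Test}$, a constant $A$, and functions $N,T:\mathbb N\to\mathbb N$ such that the following holds for every field $\mathbb F$, all integers $n\ge2$, $k\ge1$, $s\ge2$, and every list of $(ns)^{N(k)}$ distinct elements of $\mathbb F$. Put $m=s^{5k^2+2}$. There are $q\le A(1+\log_n m)$, a mapping $\mathcal L_m:\mathbb F^q\to\mathbb F^n$ whose components have individual degrees at most $n-1$ and which is a generator for the $n$-variate polynomials with at most $m$ monomials and total degree at most $n$, distinct elements $c_0,\dots,c_n\in\mathbb F$, and a set $U\subseteq\mathbb F$ of size $n^3+1$, such that for $$\mathcal H=\mathcal S_{k,m}\big((U^q)^k\times U^k\big)$$ the following hold. 1. On the input $n,k,s$ (in unary) and the list, and without a black box, $\mathsf{Alg}$ stops after at most $(ns)^{T(k)}$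 steps and outputs a list of points of $\mathbb F^n$ whose set of entries is $\mathcal H$. In particular the running time is polynomial for constant $k$. 2. $\mathcal H$ is a hitting set for the polynomials computed by low degree unmixed $\Sigma\Pi\Sigma\Pi(k)$ circuits of size $s$. 3. $|\mathcal H|\le n^{Ak}\cdot s^{Ak^3}$. 4. (Deterministic black-box identity test.) For every polynomial $P$ computed by a low degree unmixed $\Sigma\Pi\Sigma\Pi(k)$ circuit of size $s$, $\mathsf{Test}$, on the same input and with a black box for $P$, stops after at most $(ns)^{T(k)}$ steps and answers whether $P=0$. -/

import Mathlib

namespace UnmixedPIT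

noncomputable section

/-! ### Hitting sets and generators -/

/-- `H` is a hitting set for the class `M` of polynomials: every nonzero member of `M` is nonzero
at some point of `H`. -/
def IsHittingSet {F : Type*} [Field F] {n : ℕ} (H : Set (Fin n → F))
    (M : Set (MvPolynomial (Fin n) F)) : Prop :=
  ∀ P ∈ M, P ≠ 0 → ∃ a ∈ H, MvPolynomial.eval a P ≠ 0

/-- The polynomial mapping `G : F^q → F^n` is a generator for the class `M`: the composition of a
nonzero member of `M` with `G` is a nonzero polynomial. -/
def IsGenerator {F : Type*} [Field F] {n q : ℕ} (G : Fin n → MvPolynomial (Fin q) F)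
    (M : Set (MvPolynomial (Fin n) F)) : Prop :=
  ∀ P ∈ M, P ≠ 0 → MvPolynomial.bind₁ G P ≠ 0

/-- The `n`-variate polynomials with at most `m` monomials and of low degree, that is, of total
degree at most `n`. -/
def sparseLowDegree (F : Type*) [Field F] (n m : ℕ) : Set (MvPolynomial (Fin n) F) :=
  {P | P.support.card ≤ m ∧ P.totalDegree ≤ n}

/-! ### Unmixed depth-4 circuits -/

/-- An unmixed `ΣΠΣΠ(k)` circuit in `n` variables: the family of the univariate polynomials
`f i j`, standing for `∑ i, ∏ j, f i j (x_j)`. -/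
structure UnmixedCircuit (F : Type*) [Field F] (n k : ℕ) where
  f : Fin k → Fin n → Polynomial F

/-- The polynomial computed by the circuit. -/
def UnmixedCircuit.poly {F : Type*} [Field F] {n k : ℕ} (C : UnmixedCircuit F n k) :
    MvPolynomial (Fin n) F :=
  ∑ i : Fin k, ∏ j : Fin n, Polynomial.aeval (MvPolynomial.X j) (C.f i j)

/-- The circuit has size `s`: each `f i j` has at most `s` monomials. -/
def UnmixedCircuit.HasSize {F : Type*} [Field F] {n k : ℕ} (C : UnmixedCircuit F n k)
    (s : ℕ) : Prop :=
  ∀ i j, (C.f i j).support.card ≤ s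

/-- The circuit is a low degree circuit: the polynomial it computes has degree at most `n`. -/
def UnmixedCircuit.LowDegree {F : Type*} [Field F] {n k : ℕ} (C : UnmixedCircuit F n k) : Prop :=
  C.poly.totalDegree ≤ n

/-- The polynomials computed by low degree unmixed `ΣΠΣΠ(k)` circuits of size `s`. -/
def lowDegreeUnmixed (F : Type*) [Field F] (n k s : ℕ) : Set (MvPolynomial (Fin n) F) :=
  {P | ∃ C : UnmixedCircuit F n k, C.HasSize s ∧ C.LowDegree ∧ C.poly = P}

/-! ### The mapping `S` and the set that the algorithm outputs -/

/-- The polynomial of degree at most `n` with value `1` at `c j` for `j ≥ i` and `0` for `j < i`,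
where `i` runs over `1, …, n` in the mathematical text and over `0, …, n - 1` here. -/
def switchPoly {F : Type*} [Field F] {n : ℕ} (c : Fin (n + 1) → F) (i : Fin n) : Polynomial F :=
  Lagrange.interpolate Finset.univ c (fun j => if i.succ ≤ j then 1 else 0)

/-- The mapping `S_l : (F^q)^l × F^l → F^n` built from the mapping `L : F^q → F^n`. -/
def genS {F : Type*} [Field F] {n q : ℕ} (L : Fin n → MvPolynomial (Fin q) F)
    (c : Fin (n + 1) → F) : (l : ℕ) → (Fin l → Fin q → F) → (Fin l → F) → Fin n → F
  | 0, _, _, _ => 0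
  | l + 1, y, z, i =>
    genS L c l (Fin.init y) (Fin.init z) i * (switchPoly c i).eval (z (Fin.last l)) +
      MvPolynomial.eval (y (Fin.last l)) (L i) * (1 - (switchPoly c i).eval (z (Fin.last l)))

/-- The set `S_k ((U^q)^k × U^k)`. -/
def outputSet {F : Type*} [Field F] {n q : ℕ} (L : Fin n → MvPolynomial (Fin q) F)
    (c : Fin (n + 1) → F) (U : Finset F) (k : ℕ) : Set (Fin n → F) :=
  {a | ∃ (y : Fin k → Fin q → F) (z : Fin k → F),
    (∀ i j, y i j ∈ U) ∧ (∀ i, z i ∈ U) ∧ genS L c k y z = a}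

/-! ### The model of computation

Programs over binary trees whose leaves may carry field elements. Each instruction takes one unit
of time: building a cell, following a pointer, a test, a field operation, a query to the black box.
A program is a finite text that mentions no field. -/

/-- The values that programs work with. -/
inductive Value (F : Type*) where
  | nil : Value F
  | elt : F → Value F
  | cons : Value F → Value F → Value F

/-- The elementary instructions. The binary ones take the cell that holds their two arguments. -/
inductive Instr where
  | ident | empty | head | tail | zero | one | add | sub | mul | inv | isZero | query

/-- The programs. -/
inductive Prog where
  | instr : Instr → Prog
  | seq : Prog → Prog → Prog
  | fork : Prog → Prog → Prog
  | cond : Prog → Prog → Prog → Prog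
  | loop : Prog → Prog → Prog

open Classical in
/-- The effect of an instruction in the presence of the black box `box`. An instruction that does
not apply to its argument returns `nil`; `nil` is also the truth value `false`. -/
def Instr.apply {F : Type*} [Field F] (box : Value F → F) : Instr → Value F → Value F
  | .ident, x => x
  | .empty, _ => .nil
  | .head, .cons x _ => x
  | .tail, .cons _ y => y
  | .zero, _ => .elt 0
  | .one, _ => .elt 1
  | .add, .cons (.elt a) (.elt b) => .elt (a + b)
  | .sub, .cons (.elt a) (.elt b) => .elt (a - b)
  | .mul, .cons (.elt a) (.elt b) => .elt (a * b)
  | .inv, .elt a => .elt a⁻¹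
  | .isZero, .elt a => if a = 0 then .cons .nil .nil else .nil
  | .query, x => .elt (box x)
  | _, _ => .nil

/-- `Runs box p x y t`: on the argument `x` and with the black box `box`, the program `p` stops
after exactly `t` steps with the value `y`. -/
inductive Runs {F : Type*} [Field F] (box : Value F → F) :
    Prog → Value F → Value F → ℕ → Prop where
  | instr (o : Instr) (x : Value F) : Runs box (.instr o) x (o.apply box x) 1
  | seq {p q : Prog} {x y z : Value F} {a b : ℕ} :
      Runs box p x y a → Runs box q y z b → Runs box (.seq p q) x z (a + b + 1)
  | fork {p q : Prog} {x y z : Value F} {a b : ℕ} :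
      Runs box p x y a → Runs box q x z b → Runs box (.fork p q) x (.cons y z) (a + b + 1)
  | condTrue {p q r : Prog} {x v y : Value F} {a b : ℕ} :
      Runs box p x v a → v ≠ .nil → Runs box q x y b → Runs box (.cond p q r) x y (a + b + 1)
  | condFalse {p q r : Prog} {x y : Value F} {a b : ℕ} :
      Runs box p x .nil a → Runs box r x y b → Runs box (.cond p q r) x y (a + b + 1)
  | loopStop {p q : Prog} {x : Value F} {a : ℕ} :
      Runs box p x .nil a → Runs box (.loop p q) x x (a + 1)
  | loopStep {p q : Prog} {x v y z : Value F} {a b c : ℕ} :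
      Runs box p x v a → v ≠ .nil → Runs box q x y b → Runs box (.loop p q) y z c →
      Runs box (.loop p q) x z (a + b + c + 1)

/-- A list of values as a value. -/
def Value.ofList {F : Type*} : List (Value F) → Value F
  | [] => .nil
  | x :: l => .cons x (Value.ofList l)

/-- A natural number in unary. -/
def Value.ofNat (F : Type*) (n : ℕ) : Value F :=
  Value.ofList (List.replicate n .nil)

/-- A list of field elements as a value. -/
def Value.ofElts {F : Type*} (l : List F) : Value F :=
  Value.ofList (l.map .elt)

/-- A point of `F^n` as the list of its coordinates. -/
def Value.ofPoint {F : Type*} {n : ℕ} (a : Fin n → F) : Value F :=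
  Value.ofElts (List.ofFn a)

/-- The input: `n`, `k` and `s` in unary, and a list of elements of the field. -/
def Value.input {F : Type*} (n k s : ℕ) (us : List F) : Value F :=
  .cons (.ofNat F n) (.cons (.ofNat F k) (.cons (.ofNat F s) (.ofElts us)))

/-- The list of field elements that a value represents. -/
def Value.toElts {F : Type*} : Value F → List F
  | .cons (.elt a) l => a :: l.toElts
  | _ => []

/-- The black box of the polynomial `P`: it answers a query at a point by the value of `P`. -/
def blackBox {F : Type*} [Field F] {n : ℕ} (P : MvPolynomial (Fin n) F) (x : Value F) : F :=
  MvPolynomial.eval (fun i : Fin n => x.toElts.getD i 0) P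

/-- The black box without information, for programs that run without a black box. -/
def noBox (F : Type*) [Field F] : Value F → F := fun _ => 0

end

end UnmixedPIT

open UnmixedPIT

namespace UnmixedPIT

/-! ### Running times of programs whose loops are short -/

/-! Hitting. The heart is `exists_genSAlg_ne_zero`: over the algebraic closure, a nonzero sum of `k`
products of univariate polynomials, with no restriction on the factors, stays nonzero somewhere on
the image of `S_k`. Induct on the number of products. If `k + 1` products are linearly dependent,
one of them is eliminated, and the last switch is set so that it changes nothing. Otherwise take the
least `j` for which the products of the first `j` factors are independent. Freeze the remaining
coordinates at a value of `L` where no factor vanishes; independence keeps the sum nonzero. If `j >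
0`, the products of the first `j - 1` factors are dependent, so one of them is a combination of the
others; substituting it merges its `j`-th factor into the `j`-th factors of the others and leaves
`k` products. One switch joins the frozen suffix to the point that the induction supplies.

The frozen value exists because the components of `L` are transcendental: a generator for sparse
polynomials hits `x_i - r`, so no component is constant (`aeval_map_generator_ne_zero`). Each
variable has degree at most `n` in `S_k`, hence at most `n * n` after composition with a polynomial
of degree at most `n`, and a grid with `n ^ 3 + 1` values per variable contains a point where the
composition is nonzero (`isHittingSet_outputSet`).

The generator `L`. Substitute `x_i = y ^ w_i`, where `w_i` represents `(-(n + 1)) ^ i` modulo `p`.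
For some `p ≤ 2 n² m` this separates one chosen monomial from the fewer than `m` others
(`exists_weight_separates`): the differences of the exponents, read in base `-(n + 1)`, have a
nonzero product below `2 ^ (n² m)`, and such a number cannot be divisible by every modulus up to `2
n² m`. Letting `p` and `y` vary gives a hitting set of at most `n ^ 8 m ^ 2` points, and Lagrange
interpolation on a grid `W ^ q` with `|W| = n` turns it into a polynomial mapping of individual
degrees at most `n - 1` that passes through all of them (`exists_eval_gridGenerator`).

Time. A fixed program whose loops all stop within `B` rounds runs for at most `B ^ T` steps, with
`T` depending on the program alone (`Prog.exists_bound_le_pow`). So the specifications need only the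
result of a program and the fact that the lists it traverses have length at most `B`; here `B` is a
polynomial bound for the length of the output. -/

/-- A bound for the running time of a program all of whose loops stop after at most `B` rounds. -/
def Prog.bound : Prog → ℕ → ℕ
  | .instr _, _ => 1
  | .seq p q, B => p.bound B + q.bound B + 1
  | .fork p q, B => p.bound B + q.bound B + 1
  | .cond p q r, B => p.bound B + q.bound B + r.bound B + 1
  | .loop p q, B => (B + 1) * (p.bound B + q.bound B + 1)

/-- The text of the program is fixed, so only finitely many sums and loop factors occur. The
assumption `2 ≤ B` absorbs the additive constants into powers of `B`; a loop contributes `B + 1 ≤ B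
^ 2`. -/
theorem Prog.exists_bound_le_pow (p : Prog) : ∃ T, ∀ B, 2 ≤ B → p.bound B ≤ B ^ T := by
  have key : ∀ (a b : ℕ) (B : ℕ), 2 ≤ B → B ^ a + B ^ b + 1 ≤ B ^ (a + b + 2) := by
    intro a b B hB
    have h1 : B ^ a ≤ B ^ (a + b) := Nat.pow_le_pow_right (by omega) (by omega)
    have h2 : B ^ b ≤ B ^ (a + b) := Nat.pow_le_pow_right (by omega) (by omega)
    have h3 : 1 ≤ B ^ (a + b) := Nat.one_le_pow _ _ (by omega)
    have h4 : 2 ^ 2 ≤ B ^ 2 := Nat.pow_le_pow_left hB 2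
    rw [pow_add B (a + b) 2]
    nlinarith
  induction p with
  | instr o => exact ⟨0, fun B _ => by simp [Prog.bound]⟩
  | seq p q hp hq =>
    obtain ⟨a, ha⟩ := hp
    obtain ⟨b, hb⟩ := hq
    refine ⟨a + b + 2, fun B hB => le_trans ?_ (key a b B hB)⟩
    simpa [Prog.bound] using add_le_add (ha B hB) (hb B hB)
  | fork p q hp hq =>
    obtain ⟨a, ha⟩ := hp
    obtain ⟨b, hb⟩ := hq
    refine ⟨a + b + 2, fun B hB => le_trans ?_ (key a b B hB)⟩
    simpa [Prog.bound] using add_le_add (ha B hB) (hb B hB)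
  | cond p q r hp hq hr =>
    obtain ⟨a, ha⟩ := hp
    obtain ⟨b, hb⟩ := hq
    obtain ⟨c, hc⟩ := hr
    refine ⟨(a + b + 2) + c + 2, fun B hB => le_trans ?_ (key (a + b + 2) c B hB)⟩
    have := key a b B hB
    have := ha B hB
    have := hb B hB
    have := hc B hB
    simp only [Prog.bound]
    omega
  | loop p q hp hq =>
    obtain ⟨a, ha⟩ := hp
    obtain ⟨b, hb⟩ := hq
    refine ⟨2 + (a + b + 2), fun B hB => ?_⟩
    rw [pow_add]
    have h1 := key a b B hB
    have h2 := ha B hB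
    have h3 := hb B hB
    exact Nat.mul_le_mul (by nlinarith) (by omega)

/-- On the argument `x`, the program `p` stops with the value `y`, within the time that is due if
its loops stop after at most `B` rounds. -/
def RunsIn {F : Type*} [Field F] (box : Value F → F) (B : ℕ) (p : Prog) (x y : Value F) : Prop :=
  ∃ t ≤ p.bound B, Runs box p x y t

/-! ### Program constructs -/

/-- The entry `i` of a list. -/
def varP : ℕ → Prog
  | 0 => .instr .head
  | i + 1 => .seq (.instr .tail) (varP i)

/-- The empty list. -/
def nilP : Prog := .instr .empty

def headP (p : Prog) : Prog := .seq p (.instr .head)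

def tailP (p : Prog) : Prog := .seq p (.instr .tail)

/-- The value of an instruction that has one argument. -/
def unP (o : Instr) (p : Prog) : Prog := .seq p (.instr o)

/-- The value of an instruction that has two arguments. -/
def binP (o : Instr) (p q : Prog) : Prog := .seq (.fork p q) (.instr o)

/-- Evaluation of `q` after the value of `p` has been put in front of the argument. -/
def letP (p q : Prog) : Prog := .seq (.fork p (.instr .ident)) q

/-- The list of the values of some programs. -/
def listP : List Prog → Prog
  | [] => nilP
  | p :: l => .fork p (listP l)

/-- Evaluation of `f` on a list of arguments. -/
def callP (f : Prog) (l : List Prog) : Prog := .seq (listP l) f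

/-- The left fold of `b` along the list `l`, with initial value `i`. The program `b` finds the
entry of the list and the accumulated value in front of the argument. -/
def foldP (l i b : Prog) : Prog :=
  .seq (.fork l (.fork i (.instr .ident)))
    (.seq
      (.loop (.instr .head)
        (.fork (tailP (.instr .head))
          (.fork (.seq (.fork (headP (.instr .head)) (.instr .tail)) b)
            (tailP (.instr .tail)))))
      (headP (.instr .tail)))

/-- The entry `i` of a value that stands for a list. -/
def Value.entry {F : Type*} : Value F → ℕ → Value F
  | .cons x _, 0 => x
  | .cons _ y, i + 1 => y.entry i
  | _, _ => .nil

/-! ### Results and running times of the program constructs -/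

namespace RunsIn

variable {F : Type*} [Field F] {box : Value F → F} {B : ℕ} {p q r l f : Prog}
  {x y z e v w : Value F} {a b : F}

theorem instr (o : Instr) (x : Value F) : RunsIn box B (.instr o) x (o.apply box x) :=
  ⟨1, le_rfl, .instr o x⟩

theorem seq (h : RunsIn box B p x y) (h' : RunsIn box B q y z) : RunsIn box B (.seq p q) x z := by
  obtain ⟨t, ht, h⟩ := h
  obtain ⟨t', ht', h'⟩ := h'
  exact ⟨_, by simp only [Prog.bound]; omega, .seq h h'⟩

theorem fork (h : RunsIn box B p x y) (h' : RunsIn box B q x z) :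
    RunsIn box B (.fork p q) x (.cons y z) := by
  obtain ⟨t, ht, h⟩ := h
  obtain ⟨t', ht', h'⟩ := h'
  exact ⟨_, by simp only [Prog.bound]; omega, .fork h h'⟩

theorem cond (h : RunsIn box B p x v) (h₁ : v ≠ .nil → RunsIn box B q x y)
    (h₂ : v = .nil → RunsIn box B r x y) : RunsIn box B (.cond p q r) x y := by
  obtain ⟨t, ht, h⟩ := h
  by_cases hv : v = .nil
  · subst hv
    obtain ⟨t', ht', h'⟩ := h₂ rfl
    exact ⟨_, by simp only [Prog.bound]; omega, .condFalse h h'⟩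
  · obtain ⟨t', ht', h'⟩ := h₁ hv
    exact ⟨_, by simp only [Prog.bound]; omega, .condTrue h hv h'⟩

/-- Induction on the number `j` of rounds that are left. The last, failing test of the guard is paid
for by the summand `1` in the factor `B + 1` of `Prog.bound`. -/
theorem loop (N : ℕ) (hN : N ≤ B) (st : ℕ → Value F)
    (hp : ∀ i < N, ∃ v, v ≠ .nil ∧ RunsIn box B p (st i) v)
    (hq : ∀ i < N, RunsIn box B q (st i) (st (i + 1)))
    (hs : RunsIn box B p (st N) .nil) : RunsIn box B (.loop p q) (st 0) (st N) := by
  have key : ∀ j ≤ N, ∃ t ≤ j * (p.bound B + q.bound B + 1) + (p.bound B + 1),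
      Runs box (.loop p q) (st (N - j)) (st N) t := by
    intro j
    induction j with
    | zero =>
      intro _
      obtain ⟨t, ht, h⟩ := hs
      exact ⟨t + 1, by omega, .loopStop h⟩
    | succ j ih =>
      intro hj
      obtain ⟨t, ht, h⟩ := ih (by omega)
      obtain ⟨v, hv, t₁, ht₁, h₁⟩ := hp (N - (j + 1)) (by omega)
      obtain ⟨t₂, ht₂, h₂⟩ := hq (N - (j + 1)) (by omega)
      rw [show N - (j + 1) + 1 = N - j by omega] at h₂
      refine ⟨_, ?_, .loopStep h₁ hv h₂ h⟩
      rw [add_mul]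
      omega
  obtain ⟨t, ht, h⟩ := key N le_rfl
  rw [Nat.sub_self] at h
  refine ⟨t, ht.trans ?_, h⟩
  simp only [Prog.bound, add_mul, one_mul]
  have : N * (p.bound B + q.bound B + 1) ≤ B * (p.bound B + q.bound B + 1) :=
    Nat.mul_le_mul_right _ hN
  simp only [mul_add, mul_one] at this ⊢
  omega

theorem nil : RunsIn box B nilP e .nil := instr _ _

theorem ident : RunsIn box B (.instr .ident) e e := instr .ident e

theorem zero : RunsIn box B (.instr .zero) e (.elt 0) := instr _ _

theorem one : RunsIn box B (.instr .one) e (.elt 1) := instr _ _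

/-- Arguments act as environments with de Bruijn indices. In the applications the environment is an
explicit nest of cells, so `e.entry i` reduces to the wanted entry. Each `letP` shifts the indices
by one, and the body of each `foldP` by two. -/
theorem var (i : ℕ) (e : Value F) : RunsIn box B (varP i) e (e.entry i) := by
  induction i generalizing e with
  | zero => cases e <;> exact instr .head _
  | succ i ih => cases e <;> exact seq (instr .tail _) (ih _)

theorem head (h : RunsIn box B p e (.cons x y)) : RunsIn box B (headP p) e x :=
  h.seq (instr .head _)

theorem tail (h : RunsIn box B p e (.cons x y)) : RunsIn box B (tailP p) e y :=
  h.seq (instr .tail _)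

theorem tail_ofList {xs : List (Value F)} (h : RunsIn box B p e (Value.ofList xs)) :
    RunsIn box B (tailP p) e (Value.ofList xs.tail) := by
  cases xs with
  | nil => exact h.seq (instr .tail _)
  | cons x xs => exact h.tail

theorem add (h : RunsIn box B p e (.elt a)) (h' : RunsIn box B q e (.elt b)) :
    RunsIn box B (binP .add p q) e (.elt (a + b)) :=
  (h.fork h').seq (instr .add _)

theorem sub (h : RunsIn box B p e (.elt a)) (h' : RunsIn box B q e (.elt b)) :
    RunsIn box B (binP .sub p q) e (.elt (a - b)) :=
  (h.fork h').seq (instr .sub _)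

theorem mul (h : RunsIn box B p e (.elt a)) (h' : RunsIn box B q e (.elt b)) :
    RunsIn box B (binP .mul p q) e (.elt (a * b)) :=
  (h.fork h').seq (instr .mul _)

theorem inv (h : RunsIn box B p e (.elt a)) : RunsIn box B (unP .inv p) e (.elt a⁻¹) :=
  h.seq (instr .inv _)

theorem query (h : RunsIn box B p e v) : RunsIn box B (unP .query p) e (.elt (box v)) :=
  h.seq (instr .query _)

theorem ifZero (h : RunsIn box B p e (.elt a)) (h₁ : a = 0 → RunsIn box B q e v)
    (h₂ : a ≠ 0 → RunsIn box B r e v) : RunsIn box B (.cond (unP .isZero p) q r) e v := by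
  refine cond (h.seq (instr .isZero _)) (fun hv => h₁ ?_) (fun hv => h₂ ?_)
  · by_contra ha
    exact hv (by simp [Instr.apply, ha])
  · rintro rfl
    simp [Instr.apply] at hv

theorem letIn (h : RunsIn box B p e v) (h' : RunsIn box B q (.cons v e) w) :
    RunsIn box B (letP p q) e w :=
  (h.fork (instr .ident _)).seq h'

theorem call₁ (h : RunsIn box B p e x) (hf : RunsIn box B f (.ofList [x]) v) :
    RunsIn box B (callP f [p]) e v :=
  (h.fork nil).seq hf

theorem call₂ (h : RunsIn box B p e x) (h' : RunsIn box B q e y)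
    (hf : RunsIn box B f (.ofList [x, y]) v) : RunsIn box B (callP f [p, q]) e v :=
  (h.fork (h'.fork nil)).seq hf

theorem call₃ (h : RunsIn box B p e x) (h' : RunsIn box B q e y) (h'' : RunsIn box B r e z)
    (hf : RunsIn box B f (.ofList [x, y, z]) v) : RunsIn box B (callP f [p, q, r]) e v :=
  (h.fork (h'.fork (h''.fork nil))).seq hf

theorem fold {xs : List (Value F)} (hl : RunsIn box B l e (.ofList xs)) (hB : xs.length ≤ B)
    (a : ℕ → Value F) (hi : RunsIn box B p e (a 0))
    (hb : ∀ (j : ℕ) (h : j < xs.length),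
      RunsIn box B q (.cons xs[j] (.cons (a j) e)) (a (j + 1))) :
    RunsIn box B (foldP l p q) e (a xs.length) := by
  -- The state of the loop is the unread part of the list, the accumulated value and the argument.
  -- The guard is the unread part, which is `nil` exactly at the end.
  refine (hl.fork (hi.fork ident)).seq (.seq (y := .cons .nil (.cons (a xs.length) e)) ?_ ?_)
  · have := loop (box := box) (B := B) (p := .instr .head)
      (q := .fork (tailP (.instr .head))
          (.fork (.seq (.fork (headP (.instr .head)) (.instr .tail)) q)
            (tailP (.instr .tail)))) xs.length hB
      (fun j => .cons (.ofList (xs.drop j)) (.cons (a j) e)) ?_ ?_ ?_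
    · simpa [Value.ofList] using this
    · intro j hj
      refine ⟨_, ?_, instr .head _⟩
      rw [List.drop_eq_getElem_cons hj]
      simp [Instr.apply, Value.ofList]
    · intro j hj
      rw [List.drop_eq_getElem_cons hj]
      exact .fork (.tail (instr .head _)) (.fork (.seq (.fork (.head (instr .head _))
        (instr .tail _)) (hb j hj)) (.tail (instr .tail _)))
    · simpa [Value.ofList, Instr.apply] using instr (box := box) (B := B) .head
        (.cons (.ofList (xs.drop xs.length)) (.cons (a xs.length) e))
  · exact .head (instr .tail _)

theorem foldNat {N : ℕ} (hl : RunsIn box B l e (.ofNat F N)) (hB : N ≤ B) (a : ℕ → Value F)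
    (hi : RunsIn box B p e (a 0))
    (hb : ∀ j < N, RunsIn box B q (.cons .nil (.cons (a j) e)) (a (j + 1))) :
    RunsIn box B (foldP l p q) e (a N) := by
  have := fold (xs := List.replicate N .nil) hl (by simpa) a hi (q := q) ?_
  · simpa using this
  · intro j hj
    rw [List.getElem_replicate]
    exact hb j (by simpa using hj)

theorem foldl {α β : Type*} {encα : α → Value F} {encβ : β → Value F} {xs : List α} {g : β → α → β}
    {b₀ : β} (hl : RunsIn box B l e (.ofList (xs.map encα))) (hB : xs.length ≤ B)
    (hi : RunsIn box B p e (encβ b₀))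
    (hb : ∀ x ∈ xs, ∀ b, RunsIn box B q (.cons (encα x) (.cons (encβ b) e)) (encβ (g b x))) :
    RunsIn box B (foldP l p q) e (encβ (xs.foldl g b₀)) := by
  have := fold hl (by simpa) (fun j => encβ ((xs.take j).foldl g b₀)) (q := q) hi ?_
  · simpa using this
  · intro j hj
    rw [List.length_map] at hj
    simp only [List.take_add_one, List.getElem?_eq_getElem hj, Option.toList_some,
      List.foldl_append, List.foldl_cons, List.foldl_nil, List.getElem_map]
    exact hb xs[j] (List.getElem_mem hj) ((xs.take j).foldl g b₀)

end RunsIn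

/-! ### Lists built by programs -/

/-- The values of `b` for the entries of the list `l`, pushed one after the other to the list `i`.
-/
def pushP (l i b : Prog) : Prog := foldP l i (.fork b (varP 1))

/-- The reverse of the entrywise combination of two lists by `b`, which finds the two entries in
front of the argument. -/
def zipRevP (l₁ l₂ b : Prog) : Prog :=
  tailP (foldP l₁ (.fork l₂ nilP)
    (.fork (tailP (headP (varP 1)))
      (.fork (.seq (.fork (varP 0) (.fork (headP (headP (varP 1))) (tailP (.instr .tail)))) b)
        (tailP (varP 1)))))

/-- The entrywise combination of two lists by `b`. -/
def zipP (l₁ l₂ b : Prog) : Prog := pushP (zipRevP l₁ l₂ b) nilP (varP 0)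

theorem foldl_cons_eq {α β : Type*} (f : α → β) (xs : List α) (ys : List β) :
    xs.foldl (fun ys x => f x :: ys) ys = (xs.map f).reverse ++ ys := by
  induction xs generalizing ys with
  | nil => rfl
  | cons x xs ih => simp [ih]

theorem foldl_reverse_append_eq {α β : Type*} (f : α → List β) (xs : List α) (ys : List β) :
    xs.foldl (fun ys x => (f x).reverse ++ ys) ys = (xs.flatMap f).reverse ++ ys := by
  induction xs generalizing ys with
  | nil => rfl
  | cons x xs ih =>
    rw [List.foldl_cons, ih, List.flatMap_cons, List.reverse_append, List.append_assoc]

namespace Value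

variable {F : Type*}

theorem ofNat_succ (a : ℕ) : Value.ofNat F (a + 1) = .cons .nil (.ofNat F a) := rfl

theorem ofNat_eq_nil_iff {a : ℕ} : Value.ofNat F a = .nil ↔ a = 0 := by
  cases a <;> simp [Value.ofNat, Value.ofList, List.replicate_succ]

end Value

/-! ### Results of the list programs -/

namespace RunsIn

variable {F : Type*} [Field F] {box : Value F → F} {B : ℕ} {p q r l f : Prog}
  {x y z e v w : Value F} {a b : F}

theorem tail_ofNat {N : ℕ} (h : RunsIn box B p e (Value.ofNat F N)) :
    RunsIn box B (tailP p) e (Value.ofNat F (N - 1)) := by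
  have := h.tail_ofList
  rwa [List.tail_replicate] at this

/-- Pushing in front reverses the order. This is the source of the reversals in the lists defined
below, which follow the programs literally. -/
theorem push {α : Type*} {enc : α → Value F} {xs : List α} {ys : List (Value F)} (f : α → Value F)
    (hl : RunsIn box B l e (.ofList (xs.map enc))) (hB : xs.length ≤ B)
    (hi : RunsIn box B p e (.ofList ys))
    (hb : ∀ x ∈ xs, ∀ v, RunsIn box B q (.cons (enc x) (.cons v e)) (f x)) :
    RunsIn box B (pushP l p q) e (.ofList ((xs.map f).reverse ++ ys)) := by
  have := foldl (box := box) (l := l) (p := p) (q := .fork q (varP 1)) (xs := xs) (encα := enc)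
    (encβ := Value.ofList) (g := fun ys x => f x :: ys) (b₀ := ys) hl hB hi
    (fun x hx v => (hb x hx _).fork (.var 1 _))
  rwa [foldl_cons_eq] at this

/-- Nested loops hand the accumulated list through the inner loop, so a list of combinations is
produced without concatenating lists. -/
theorem flatFold {α : Type*} {enc : α → Value F} {xs : List α} {ys : List (Value F)}
    (f : α → List (Value F))
    (hl : RunsIn box B l e (.ofList (xs.map enc))) (hB : xs.length ≤ B)
    (hi : RunsIn box B p e (.ofList ys))
    (hb : ∀ x ∈ xs, ∀ ys, RunsIn box B q (.cons (enc x) (.cons (.ofList ys) e))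
      (.ofList ((f x).reverse ++ ys))) :
    RunsIn box B (foldP l p q) e (.ofList ((xs.flatMap f).reverse ++ ys)) := by
  have := foldl (box := box) (l := l) (p := p) (q := q) (xs := xs) (encα := enc)
    (encβ := Value.ofList) (g := fun ys x => (f x).reverse ++ ys) (b₀ := ys) hl hB hi
    (fun x hx v => hb x hx v)
  rwa [foldl_reverse_append_eq] at this

/-- The accumulated value is a pair: the unread part of the second list and the result so far. The
result comes out reversed, and `zipP` reverses it once more. -/
theorem zipRev {n : ℕ} {u v : Fin n → F} (g : F → F → F) (hB : n ≤ B)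
    (h₁ : RunsIn box B p e (.ofPoint u)) (h₂ : RunsIn box B q e (.ofPoint v))
    (hb : ∀ a b, RunsIn box B r (.cons (.elt a) (.cons (.elt b) e)) (.elt (g a b))) :
    RunsIn box B (zipRevP p q r) e
      (.ofElts (List.ofFn fun i => g (u i) (v i)).reverse) := by
  have := fold (box := box) (B := B) (l := p) (e := e) (p := .fork q nilP)
    (q := (.fork (tailP (headP (varP 1)))
      (.fork (.seq (.fork (varP 0) (.fork (headP (headP (varP 1))) (tailP (.instr .tail)))) r)
        (tailP (varP 1)))))
    (xs := (List.ofFn u).map .elt) h₁ (by simpa)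
    (fun j => .cons (.ofElts ((List.ofFn v).drop j))
      (.ofElts ((List.ofFn fun i => g (u i) (v i)).take j).reverse))
    (h₂.fork nil) (fun j hj => ?_)
  · have := this.tail
    rw [List.length_map, List.length_ofFn, List.take_of_length_le (by simp)] at this
    exact this
  · simp only [List.length_map, List.length_ofFn] at hj
    rw [List.drop_eq_getElem_cons (by simpa using hj), List.take_add_one,
      List.getElem?_eq_getElem (by simpa using hj)]
    simp only [List.getElem_map, List.getElem_ofFn, Option.toList_some, List.reverse_append,
      List.reverse_cons, List.reverse_nil, List.nil_append, List.singleton_append]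
    exact .fork (.tail (.head (.var 1 _))) (.fork (.seq (.fork (.var 0 _) (.fork
      (.head (.head (.var 1 _))) (.tail (instr .tail _)))) (hb _ _)) (.tail (.var 1 _)))

theorem zipWith {n : ℕ} {u v : Fin n → F} (g : F → F → F) (hB : n ≤ B)
    (h₁ : RunsIn box B p e (.ofPoint u)) (h₂ : RunsIn box B q e (.ofPoint v))
    (hb : ∀ a b, RunsIn box B r (.cons (.elt a) (.cons (.elt b) e)) (.elt (g a b))) :
    RunsIn box B (zipP p q r) e (.ofPoint fun i => g (u i) (v i)) := by
  have := push (ys := []) .elt (zipRev g hB h₁ h₂ hb) (by simpa) nil (q := varP 0)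
    (fun _ _ _ => .var 0 _)
  rw [List.append_nil, List.map_reverse, List.reverse_reverse] at this
  exact this

end RunsIn

/-! ### Unary arithmetic -/

/-- The numeral `c`. -/
def numP (c : ℕ) : Prog := listP (List.replicate c nilP)

/-- Addition of two numbers. -/
def natAddP : Prog := foldP (varP 0) (varP 1) (.fork nilP (varP 1))

/-- Multiplication of two numbers. -/
def natMulP : Prog := foldP (varP 0) nilP (callP natAddP [varP 3, varP 1])

/-- The power of two numbers. -/
def natPowP : Prog := foldP (varP 1) (numP 1) (callP natMulP [varP 2, varP 1])

/-- Removal of the first `a` entries of a list. -/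
def dropP : Prog := foldP (varP 0) (varP 1) (tailP (varP 1))

/-- The first `a` entries of a list, in the reverse order. -/
def takeP : Prog :=
  tailP (foldP (varP 0) (.fork (varP 1) nilP)
    (.fork (tailP (headP (varP 1))) (.fork (headP (headP (varP 1))) (tailP (varP 1)))))

/-- One step in the search of the least power of `n` that is at least `m`. -/
def clogStep (n m : ℕ) (a : ℕ × ℕ) : ℕ × ℕ := if a.1 < m then (n * a.1, a.2 + 1) else a

/-- The exponent of a power of `n` that is at least `m` and less than `n * m`. -/
def clogAux (n m : ℕ) : ℕ := ((clogStep n m)^[m] (1, 0)).2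

/-- The program for `clogAux`. -/
def clogP : Prog :=
  tailP (foldP (varP 1) (.fork (numP 1) nilP)
    -- The comparison in unary: removing the first component of the state from `m` leaves a nonempty
    -- list exactly if that component is less than `m`.
    (.cond (callP dropP [headP (varP 1), varP 3])
      (.fork (callP natMulP [varP 2, headP (varP 1)]) (.fork nilP (tailP (varP 1))))
      (varP 1)))

/-- The last alternative shows that `m` rounds suffice: a search that has not reached `m` has raised
the exponent in every round, and `m < n ^ m`. The upper bound `n * m` holds because a multiplication
by `n` takes place only below `m`. -/
theorem clogStep_iterate {n m : ℕ} (hn : 2 ≤ n) (hm : 1 ≤ m) (j : ℕ) :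
    ((clogStep n m)^[j] (1, 0)).1 = n ^ ((clogStep n m)^[j] (1, 0)).2 ∧
    ((clogStep n m)^[j] (1, 0)).1 ≤ n * m ∧
    (m ≤ ((clogStep n m)^[j] (1, 0)).1 ∨ ((clogStep n m)^[j] (1, 0)).2 = j) := by
  induction j with
  | zero => simpa using Nat.mul_le_mul (show 1 ≤ n by omega) hm
  | succ j ih =>
    obtain ⟨h₁, h₂, h₃⟩ := ih
    rw [Function.iterate_succ_apply']
    generalize (clogStep n m)^[j] (1, 0) = a at *
    unfold clogStep
    split_ifs with h
    · refine ⟨by simp only [h₁, pow_succ]; ring, Nat.mul_le_mul_left _ h.le, .inr ?_⟩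
      simp only
      omega
    · exact ⟨h₁, h₂, .inl (by omega)⟩

theorem le_pow_clogAux {n m : ℕ} (hn : 2 ≤ n) (hm : 1 ≤ m) : m ≤ n ^ clogAux n m := by
  obtain ⟨h₁, -, h₃⟩ := clogStep_iterate hn hm m
  unfold clogAux
  rcases h₃ with h | h
  · rwa [← h₁]
  · rw [h]
    exact (Nat.lt_pow_self (by omega)).le

theorem pow_clogAux_le {n m : ℕ} (hn : 2 ≤ n) (hm : 1 ≤ m) : n ^ clogAux n m ≤ n * m := by
  obtain ⟨h₁, h₂, -⟩ := clogStep_iterate hn hm m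
  unfold clogAux
  rwa [← h₁]

/-! ### Correctness of the unary arithmetic -/

section Specifications

variable {F : Type*} [Field F] {box : Value F → F} {B : ℕ}

theorem RunsIn.num (c : ℕ) (e : Value F) : RunsIn box B (numP c) e (.ofNat F c) := by
  induction c with
  | zero => exact .nil
  | succ c ih => exact .fork .nil ih

theorem runsIn_natAddP {a b : ℕ} (ha : a ≤ B) :
    RunsIn box B natAddP (.ofList [.ofNat F a, .ofNat F b]) (.ofNat F (a + b)) := by
  refine RunsIn.foldNat (.var 0 _) ha (fun j => .ofNat F (j + b)) ?_ fun j _ => ?_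
  · rw [Nat.zero_add]
    exact .var 1 _
  · rw [Nat.add_right_comm, Value.ofNat_succ]
    exact .fork .nil (.var 1 _)

theorem runsIn_natMulP {a b : ℕ} (ha : a ≤ B) (hb : b ≤ B) :
    RunsIn box B natMulP (.ofList [.ofNat F a, .ofNat F b]) (.ofNat F (a * b)) := by
  refine RunsIn.foldNat (.var 0 _) ha (fun j => .ofNat F (j * b)) ?_ fun j _ => ?_
  · rw [Nat.zero_mul]
    exact .nil
  · rw [Nat.succ_mul, Nat.add_comm]
    exact .call₂ (.var 3 _) (.var 1 _) (runsIn_natAddP hb)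

theorem runsIn_natPowP {a b : ℕ} (ha : a ≤ B) (hb : b ≤ B) (hab : a ^ b ≤ B) :
    RunsIn box B natPowP (.ofList [.ofNat F a, .ofNat F b]) (.ofNat F (a ^ b)) := by
  refine RunsIn.foldNat (.var 1 _) hb (fun j => .ofNat F (a ^ j)) (.num _ _) fun j hj => ?_
  rw [pow_succ']
  refine .call₂ (.var 2 _) (.var 1 _) (runsIn_natMulP ha ?_)
  rcases Nat.eq_zero_or_pos a with rfl | h
  · rcases Nat.eq_zero_or_pos j with rfl | h
    · simp only [pow_zero]
      omega
    · rw [zero_pow h.ne']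
      omega
  · exact (Nat.pow_le_pow_right h hj.le).trans hab

theorem runsIn_dropP {a : ℕ} {xs : List (Value F)} (ha : a ≤ B) :
    RunsIn box B dropP (.ofList [.ofNat F a, .ofList xs]) (.ofList (xs.drop a)) := by
  refine RunsIn.foldNat (.var 0 _) ha (fun j => .ofList (xs.drop j)) (.var 1 _) fun j _ => ?_
  rw [← List.tail_drop]
  exact .tail_ofList (.var 1 _)

theorem runsIn_takeP {a : ℕ} {us : List F} (ha : a ≤ B) (hus : a ≤ us.length) :
    RunsIn box B takeP (.ofList [.ofNat F a, .ofElts us]) (.ofElts (us.take a).reverse) := by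
  refine .tail (.foldNat (.var 0 _) ha
    (fun j => .cons (.ofElts (us.drop j)) (.ofElts (us.take j).reverse))
    (.fork (.var 1 _) .nil) fun j hj => ?_)
  rw [List.drop_eq_getElem_cons (by omega), List.take_add_one,
      List.getElem?_eq_getElem (by omega)]
  simp only [Option.toList_some, List.reverse_append, List.reverse_cons, List.reverse_nil,
    List.nil_append, List.singleton_append]
  exact .fork (.tail (.head (.var 1 _))) (.fork (.head (.head (.var 1 _))) (.tail (.var 1 _)))

theorem runsIn_clogP {n m : ℕ} (hn : 2 ≤ n) (hm : 1 ≤ m) (hB : n * m ≤ B) :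
    RunsIn box B clogP (.ofList [.ofNat F n, .ofNat F m]) (.ofNat F (clogAux n m)) := by
  have hnB : n ≤ B := le_trans (by nlinarith) hB
  have hmB : m ≤ B := le_trans (by nlinarith) hB
  refine .tail (.foldNat (.var 1 _) hmB
    (fun j => .cons (.ofNat F ((clogStep n m)^[j] (1, 0)).1)
      (.ofNat F ((clogStep n m)^[j] (1, 0)).2))
    (.fork (.num 1 _) .nil) fun j hj => ?_)
  obtain ⟨-, h₂, -⟩ := clogStep_iterate hn hm j
  rw [Function.iterate_succ_apply']
  generalize (clogStep n m)^[j] (1, 0) = a at *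
  have hd := runsIn_dropP (box := box) (B := B) (a := a.1) (xs := List.replicate m .nil)
    (h₂.trans hB)
  rw [List.drop_replicate] at hd
  refine .cond (.call₂ (.head (.var 1 _)) (.var 3 _) hd) (fun h => ?_) (fun h => ?_)
  · have : a.1 < m := by
      by_contra h'
      exact h (Value.ofNat_eq_nil_iff.2 (by omega))
    rw [clogStep, if_pos this]
    exact .fork (.call₂ (.var 2 _) (.head (.var 1 _)) (runsIn_natMulP hnB (h₂.trans hB)))
      (.fork .nil (.tail (.var 1 _)))
  · have : ¬ a.1 < m := by
      have := Value.ofNat_eq_nil_iff.1 h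
      omega
    rw [clogStep, if_neg this]
    exact .var 1 _

end Specifications

noncomputable section

/-! ### Interpolation on a grid -/

section Interpolation

variable {F R : Type*} [Field F] [CommRing R] [Algebra F R]

open Classical in
/-- The value at `y` of the polynomial that is `1` at the entry `w` of `W` and vanishes at the other
entries of `W`. -/
def lagrangeVal (W : List F) (w : F) (y : R) : R :=
  (W.map fun x =>
    if w = x then 1 else (y - algebraMap F R x) * algebraMap F R (w - x)⁻¹).prod

/-- The values at `y` of the interpolation polynomials for the entries of `W`. -/
def lagrangeRow (W : List F) (y : R) : List R :=
  (W.map fun w => lagrangeVal W w y).reverse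

/-- The products of the entries of two lists. -/
def tensor (u v : List R) : List R := (u.flatMap fun b => v.map (b * ·)).reverse

/-- The values at `y` of the interpolation polynomials for the points of the grid `W^q`. -/
def lagrangeTensor (W : List F) : (q : ℕ) → (Fin q → R) → List R
  | 0, _ => [1]
  | q + 1, y => tensor (lagrangeRow W (y (Fin.last q))) (lagrangeTensor W q (Fin.init y))

/-- The linear combination of the points in `h` with the coefficients `u`. -/
def dot {n : ℕ} (u : List R) (h : List (Fin n → F)) (i : Fin n) : R :=
  ∑ j ∈ Finset.range h.length, u.getD j 0 * algebraMap F R (h.getD j 0 i)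

/-- The values of the interpolation polynomials for the points of the grid `W^q` at the points of
the grid `U^q`. -/
def lagrangeTable (W U : List F) : ℕ → List (List F)
  | 0 => [[1]]
  | q + 1 => ((lagrangeTable W U q).flatMap fun u =>
      (U.map (lagrangeRow W (R := F))).reverse.map fun r => tensor r u).reverse

theorem dot_eq {n : ℕ} (u : List F) (h : List (Fin n → F)) :
    dot u h = fun i => ∑ j ∈ Finset.range h.length, u.getD j 0 * h.getD j 0 i := rfl

@[simp]
theorem length_lagrangeRow (W : List F) (y : R) : (lagrangeRow W y).length = W.length := by
  simp [lagrangeRow]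

@[simp]
theorem length_tensor (u v : List R) : (tensor u v).length = u.length * v.length := by
  simp [tensor, List.length_flatMap, List.map_const']

@[simp]
theorem length_lagrangeTensor (W : List F) (q : ℕ) (y : Fin q → R) :
    (lagrangeTensor W q y).length = W.length ^ q := by
  induction q with
  | zero => rfl
  | succ q ih => simp [lagrangeTensor, ih, pow_succ']

theorem length_of_mem_lagrangeTable {W U : List F} {q : ℕ} {u : List F}
    (hu : u ∈ lagrangeTable W U q) : u.length = W.length ^ q := by
  induction q generalizing u with
  | zero => simp_all [lagrangeTable]
  | succ q ih =>
    simp only [lagrangeTable, List.mem_reverse, List.mem_flatMap, List.mem_map] at hu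
    obtain ⟨v, hv, r, ⟨x, -, rfl⟩, rfl⟩ := hu
    simp [ih hv, pow_succ']

theorem length_lagrangeTable (W U : List F) (q : ℕ) :
    (lagrangeTable W U q).length = U.length ^ q := by
  induction q with
  | zero => rfl
  | succ q ih => simp [lagrangeTable, List.length_flatMap, List.map_const', ih, pow_succ]

theorem mem_lagrangeTable {W U : List F} {q : ℕ} {u : List F} :
    u ∈ lagrangeTable W U q ↔
      ∃ y : Fin q → F, (∀ j, y j ∈ U) ∧ lagrangeTensor W q y = u := by
  induction q generalizing u with
  | zero => simp [lagrangeTable, lagrangeTensor, eq_comm]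
  | succ q ih =>
    simp only [lagrangeTable, List.mem_reverse, List.mem_flatMap, List.mem_map, ih,
      lagrangeTensor]
    constructor
    · rintro ⟨_, ⟨y, hy, rfl⟩, _, ⟨x, hx, rfl⟩, rfl⟩
      refine ⟨Fin.snoc y x, fun j => ?_, by simp⟩
      induction j using Fin.lastCases <;> simp [hx, hy]
    · rintro ⟨y, hy, rfl⟩
      exact ⟨_, ⟨Fin.init y, fun j => hy _, rfl⟩, _, ⟨_, hy _, rfl⟩, rfl⟩

end Interpolation

/-! ### Programs for interpolation -/

/-- The program for `lagrangeVal`, with the arguments `w`, `y`, `W`. -/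
def lagrangeValP : Prog :=
  foldP (varP 2) (.instr .one)
    (binP .mul (varP 1) (.cond (unP .isZero (binP .sub (varP 2) (varP 0))) (.instr .one)
      (binP .mul (binP .sub (varP 3) (varP 0)) (unP .inv (binP .sub (varP 2) (varP 0))))))

/-- The program for `lagrangeRow`, with the arguments `y`, `W`. -/
def lagrangeRowP : Prog :=
  pushP (varP 1) nilP (callP lagrangeValP [varP 0, varP 2, varP 3])

/-- The program for `tensor`. -/
def tensorP : Prog :=
  foldP (varP 0) nilP (pushP (varP 3) (varP 1) (binP .mul (varP 2) (varP 0)))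

/-- The program for `lagrangeTable`, with the arguments `q`, `W`, `U`. -/
def lagrangeTableP : Prog :=
  letP (pushP (varP 2) nilP (callP lagrangeRowP [varP 0, varP 3]))
    (foldP (varP 1) (listP [listP [.instr .one]])
      (foldP (varP 1) nilP (pushP (varP 4) (varP 1) (callP tensorP [varP 0, varP 2]))))

/-- The zero vector with as many entries as the argument. -/
def zeroP : Prog := pushP (varP 0) nilP (.instr .zero)

/-- The point `a + c • h`, with the arguments `c`, `h`, `a`. -/
def addSmulP : Prog :=
  zipP (varP 2) (varP 1) (binP .add (varP 0) (binP .mul (varP 2) (varP 1)))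

/-- The program for `dot`, with the coefficients, the points and the zero vector as arguments. -/
def dotP : Prog :=
  tailP (foldP (varP 1) (.fork (varP 0) (varP 2))
    (.fork (tailP (headP (varP 1)))
      (callP addSmulP [headP (headP (varP 1)), varP 0, tailP (varP 1)])))

/-! ### Correctness of the interpolation programs -/

section Specifications

variable {F : Type*} [Field F] {box : Value F → F} {B : ℕ}

theorem runsIn_lagrangeValP {w y : F} {W : List F} (hW : W.length ≤ B) :
    RunsIn box B lagrangeValP (.ofList [.elt w, .elt y, .ofElts W])
      (.elt (lagrangeVal W w y)) := by
  classical
  have h : lagrangeVal W w y = W.foldl (fun a x => a *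
      if w = x then 1 else (y - x) * (w - x)⁻¹) 1 := by
    rw [lagrangeVal, List.prod_eq_foldl, List.foldl_map]
    congr! 4
  rw [h]
  refine .foldl (encβ := .elt) (.var 2 _) hW .one fun x _ a => ?_
  refine .mul (.var 1 _) (.ifZero (.sub (.var 2 _) (.var 0 _)) (fun h => ?_) (fun h => ?_))
  · rw [if_pos (sub_eq_zero.1 h)]
    exact .one
  · rw [if_neg (fun h' => h (sub_eq_zero.2 h'))]
    exact .mul (.sub (.var 3 _) (.var 0 _)) (.inv (.sub (.var 2 _) (.var 0 _)))

theorem runsIn_lagrangeRowP {y : F} {W : List F} (hW : W.length ≤ B) :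
    RunsIn box B lagrangeRowP (.ofList [.elt y, .ofElts W]) (.ofElts (lagrangeRow W y)) := by
  have := RunsIn.push (box := box) (B := B) (e := .ofList [.elt y, .ofElts W]) (enc := .elt)
    (l := varP 1) (p := nilP) (q := callP lagrangeValP [varP 0, varP 2, varP 3]) (xs := W)
    (ys := []) (fun w => .elt (lagrangeVal W w y)) (.var 1 _) hW .nil
    (fun x _ v => .call₃ (.var 0 _) (.var 2 _) (.var 3 _) (runsIn_lagrangeValP hW))
  simpa [lagrangeRowP, lagrangeRow, Value.ofElts, Function.comp_def] using this

theorem runsIn_tensorP {u v : List F} (hu : u.length ≤ B) (hv : v.length ≤ B) :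
    RunsIn box B tensorP (.ofList [.ofElts u, .ofElts v]) (.ofElts (tensor u v)) := by
  have := RunsIn.flatFold (box := box) (B := B) (e := .ofList [.ofElts u, .ofElts v]) (enc := .elt)
    (l := varP 0) (p := nilP) (q := pushP (varP 3) (varP 1) (binP .mul (varP 2) (varP 0)))
    (xs := u) (ys := []) (fun b => v.map fun c => .elt (b * c)) (.var 0 _) hu .nil
    (fun x _ ys => .push (enc := .elt) _ (.var 3 _) hv (.var 1 _)
      fun c _ v => .mul (.var 2 _) (.var 0 _))
  simpa [tensorP, tensor, Value.ofElts, List.map_flatMap, Function.comp_def] using this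

/-- Stage `j + 1` loops over the table of stage `j` and over its rows, so only the sizes of the
stages before the last one have to be at most `B`. -/
theorem runsIn_lagrangeTableP {q : ℕ} {W U : List F} (hq : q ≤ B) (hW : W.length ≤ B)
    (hU : U.length ≤ B) (hW' : ∀ j < q, W.length ^ j ≤ B) (hU' : ∀ j < q, U.length ^ j ≤ B) :
    RunsIn box B lagrangeTableP (.ofList [.ofNat F q, .ofElts W, .ofElts U])
      (.ofList ((lagrangeTable W U q).map .ofElts)) := by
  have h₁ : RunsIn box B (pushP (varP 2) nilP (callP lagrangeRowP [varP 0, varP 3]))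
      (.ofList [.ofNat F q, .ofElts W, .ofElts U])
      (.ofList ((U.map (lagrangeRow W (R := F))).reverse.map .ofElts)) := by
    have := RunsIn.push (box := box) (B := B) (e := .ofList [.ofNat F q, .ofElts W, .ofElts U])
      (enc := .elt) (l := varP 2) (p := nilP) (q := callP lagrangeRowP [varP 0, varP 3]) (xs := U)
      (ys := []) (fun y => .ofElts (lagrangeRow W y)) (.var 2 _) hU .nil
      (fun x _ v => .call₂ (.var 0 _) (.var 3 _) (runsIn_lagrangeRowP hW))
    simpa [Function.comp_def] using this
  refine .letIn h₁ (.foldNat (.var 1 _) hq (fun j => .ofList ((lagrangeTable W U j).map .ofElts))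
    (.fork (.fork .one .nil) .nil) fun j hj => ?_)
  have := RunsIn.flatFold (box := box) (B := B)
    (e := .cons .nil (.cons (.ofList ((lagrangeTable W U j).map .ofElts))
      (.cons (.ofList ((U.map (lagrangeRow W (R := F))).reverse.map .ofElts))
        (.ofList [.ofNat F q, .ofElts W, .ofElts U]))))
    (enc := .ofElts) (l := varP 1) (p := nilP)
    (q := pushP (varP 4) (varP 1) (callP tensorP [varP 0, varP 2])) (xs := lagrangeTable W U j)
    (ys := []) (fun u => (U.map (lagrangeRow W (R := F))).reverse.map fun r =>
      .ofElts (tensor r u)) (.var 1 _) (by rw [length_lagrangeTable]; exact hU' j hj) .nil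
    (fun u hu ys => .push (enc := .ofElts) _ (.var 4 _) (by simpa) (.var 1 _)
      fun r hr v => .call₂ (.var 0 _) (.var 2 _) (runsIn_tensorP ?_ ?_))
  · simpa [lagrangeTable, List.map_flatMap, Function.comp_def] using this
  · simp only [List.mem_reverse, List.mem_map] at hr
    obtain ⟨x, -, rfl⟩ := hr
    simpa
  · rw [length_of_mem_lagrangeTable hu]
    exact hW' j hj

theorem runsIn_zeroP {n : ℕ} (hn : n ≤ B) :
    RunsIn box B zeroP (.ofList [.ofNat F n]) (.ofPoint (0 : Fin n → F)) := by
  have := RunsIn.push (box := box) (B := B) (e := .ofList [.ofNat F n]) (enc := fun _ : Unit => .nil)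
    (xs := List.replicate n ()) (ys := []) (l := varP 0) (p := nilP) (q := .instr .zero)
    (fun _ => .elt (0 : F)) (by
      rw [List.map_replicate]
      exact .var 0 _)
    (by simpa) .nil (fun _ _ _ => .zero)
  simpa [zeroP, Value.ofPoint, Value.ofElts, Function.comp_def] using this

theorem runsIn_addSmulP {n : ℕ} {c : F} {h a : Fin n → F} (hn : n ≤ B) :
    RunsIn box B addSmulP (.ofList [.elt c, .ofPoint h, .ofPoint a]) (.ofPoint (a + c • h)) :=
  .zipWith (fun x y => x + c * y) hn (.var 2 _) (.var 1 _)
    fun _ _ => .add (.var 0 _) (.mul (.var 2 _) (.var 1 _))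

theorem runsIn_dotP {n : ℕ} {u : List F} {h : List (Fin n → F)} (hn : n ≤ B) (hB : h.length ≤ B)
    (hu : h.length ≤ u.length) :
    RunsIn box B dotP (.ofList [.ofElts u, .ofList (h.map .ofPoint), .ofPoint (0 : Fin n → F)])
      (.ofPoint (dot u h)) := by
  have := RunsIn.fold (box := box) (B := B)
    (e := .ofList [.ofElts u, .ofList (h.map .ofPoint), .ofPoint (0 : Fin n → F)])
    (xs := h.map .ofPoint) (l := varP 1) (p := .fork (varP 0) (varP 2))
    (q := (.fork (tailP (headP (varP 1)))
      (callP addSmulP [headP (headP (varP 1)), varP 0, tailP (varP 1)])))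
    (.var 1 _) (by simpa) (fun j => .cons (.ofElts (u.drop j))
      (.ofPoint fun i => ∑ j ∈ Finset.range j, u.getD j 0 * h.getD j 0 i))
    (.fork (.var 0 _) (.var 2 _)) (fun j hj => ?_)
  · simpa [dotP, dot_eq, Function.comp_def] using this.tail
  · rw [List.length_map] at hj
    rw [List.drop_eq_getElem_cons (by omega), List.getElem_map]
    refine .fork (.tail (.head (.var 1 _))) (.call₃ (.head (.head (.var 1 _))) (.var 0 _)
      (.tail (.var 1 _)) ?_)
    have := runsIn_addSmulP (box := box) (h := h[j]) (c := u[j])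
      (a := fun i => ∑ j ∈ Finset.range j, u.getD j 0 * h.getD j 0 i) hn
    refine cast ?_ this
    congr 2
    ext i
    simp [Finset.sum_range_succ, List.getD_eq_getElem?_getD, List.getElem?_eq_getElem hj,
      List.getElem?_eq_getElem (show j < u.length by omega)]

end Specifications

/-! ### The points that separate monomials -/

/-- The predecessor of `r` among the representatives `1, …, p` of the residues modulo `p`. -/
def decMod (p r : ℕ) : ℕ := if r ≤ 1 then p else r - 1

/-- A representative of the residue of `(-(n + 1)) ^ i` modulo `p`. -/
def weight (n p : ℕ) : ℕ → ℕ
  | 0 => 1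
  | i + 1 => (decMod p)^[(n + 1) * weight n p i] p

/-- The program for the list of the weights in the reverse order, with the arguments `p`, `n`,
`n + 1`. -/
def weightsP : Prog :=
  tailP (foldP (varP 1) (.fork (numP 1) nilP)
    (.fork
      (foldP (callP natMulP [varP 4, headP (varP 1)]) (varP 2)
        -- The tail of the unary `r` is `r - 1`; it is empty exactly for `r ≤ 1`, the case that
        -- wraps around to `p`. Under two folds, `varP 4` is `p`.
        (.cond (tailP (varP 1)) (tailP (varP 1)) (varP 4)))
      (.fork (headP (varP 1)) (tailP (varP 1)))))

/-- The power of a field element. -/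
def powP : Prog := foldP (varP 1) (.instr .one) (binP .mul (varP 1) (varP 2))

/-- The point whose coordinates are the powers of `y`. -/
def weightPoint {F : Type*} [Field F] (n p : ℕ) (y : F) (i : Fin n) : F := y ^ weight n p i

/-- The program for `weightPoint`, with `y` and the reversed list of the weights as arguments. -/
def weightPointP : Prog := pushP (varP 1) nilP (callP powP [varP 2, varP 0])

/-- The points that belong to the moduli `1, …, R` and the elements of `Y`. -/
def pointTable {F : Type*} [Field F] (n : ℕ) (Y : List F) : ℕ → List (Fin n → F)
  | 0 => []
  | R + 1 => (Y.map (weightPoint n (R + 1))).reverse ++ pointTable n Y R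

/-- The program for `pointTable`, with the arguments `R`, `Y`, `n`, `n + 1`. -/
def pointTableP : Prog :=
  tailP (foldP (varP 0) (.fork (numP 1) nilP)
    (letP (callP weightsP [headP (varP 1), varP 4, varP 5])
      (.fork (.fork nilP (headP (varP 2)))
        (pushP (varP 4) (tailP (varP 2)) (callP weightPointP [varP 0, varP 2])))))

theorem decMod_pos {p : ℕ} (hp : 1 ≤ p) (r : ℕ) : 1 ≤ decMod p r := by
  unfold decMod
  split_ifs <;> omega

theorem decMod_le {p r : ℕ} (hr : r ≤ p) : decMod p r ≤ p := by
  unfold decMod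
  split_ifs <;> omega

theorem iterate_decMod_le (p j : ℕ) : (decMod p)^[j] p ≤ p := by
  induction j with
  | zero => rfl
  | succ j ih =>
    rw [Function.iterate_succ_apply']
    exact decMod_le ih

theorem weight_le {p : ℕ} (hp : 1 ≤ p) (n i : ℕ) : weight n p i ≤ p := by
  cases i with
  | zero => exact hp
  | succ i => exact iterate_decMod_le _ _

/-! ### Sizes and correctness for the weights and the points -/

section

variable {F : Type*} [Field F]

theorem length_pointTable (n : ℕ) (Y : List F) (R : ℕ) :
    (pointTable n Y R).length = R * Y.length := by
  induction R with
  | zero => simp [pointTable]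
  | succ R ih => simp [pointTable, ih, Nat.succ_mul, Nat.add_comm]

theorem weightPoint_mem_pointTable {n R p : ℕ} {Y : List F} {y : F} (hp : 1 ≤ p) (hR : p ≤ R)
    (hy : y ∈ Y) : weightPoint n p y ∈ pointTable n Y R := by
  induction R with
  | zero => omega
  | succ R ih =>
    rw [pointTable, List.mem_append]
    rcases hR.lt_or_eq with h | rfl
    · exact .inr (ih (by omega))
    · exact .inl (List.mem_reverse.2 (List.mem_map_of_mem hy))

variable {box : Value F → F} {B : ℕ}

theorem runsIn_weightsP {p n : ℕ} (hp : 1 ≤ p) (hn : n + 1 ≤ B) (hB : (n + 1) * p ≤ B) :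
    RunsIn box B weightsP (.ofList [.ofNat F p, .ofNat F n, .ofNat F (n + 1)])
      (.ofList ((List.range n).reverse.map fun i => .ofNat F (weight n p i))) := by
  refine .tail (.foldNat (.var 1 _) (by omega)
    (fun j => .cons (.ofNat F (weight n p j))
      (.ofList ((List.range j).reverse.map fun i => .ofNat F (weight n p i))))
    (.fork (.num 1 _) .nil) fun j hj => ?_)
  have hw := weight_le hp n j
  have hpB : p ≤ B := le_trans (by nlinarith) hB
  rw [List.range_succ, List.reverse_append]
  refine .fork ?_ (.fork (.head (.var 1 _)) (.tail (.var 1 _)))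
  refine .foldNat (.call₂ (.var 4 _) (.head (.var 1 _)) (runsIn_natMulP hn (hw.trans hpB)))
    ((Nat.mul_le_mul_left _ hw).trans hB) (fun i => .ofNat F ((decMod p)^[i] p))
    (.var 2 _) fun i _ => ?_
  rw [Function.iterate_succ_apply']
  generalize (decMod p)^[i] p = r
  have ht : ∀ e : Value F, RunsIn box B (tailP (varP 1))
      (.cons .nil (.cons (.ofNat F r) e)) (.ofNat F (r - 1)) :=
    fun e => .tail_ofNat (.var 1 _)
  refine .cond (ht _) (fun h => ?_) (fun h => ?_)
  · rw [Ne, Value.ofNat_eq_nil_iff] at h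
    rw [decMod, if_neg (by omega)]
    exact ht _
  · rw [Value.ofNat_eq_nil_iff] at h
    rw [decMod, if_pos (by omega)]
    exact .var 4 _

theorem runsIn_powP {y : F} {b : ℕ} (hb : b ≤ B) :
    RunsIn box B powP (.ofList [.elt y, .ofNat F b]) (.elt (y ^ b)) := by
  refine .foldNat (.var 1 _) hb (fun j => .elt (y ^ j)) ?_ fun j _ => ?_
  · rw [pow_zero]
    exact .one
  · rw [pow_succ]
    exact .mul (.var 1 _) (.var 2 _)

theorem runsIn_weightPointP {p n : ℕ} {y : F} (hp : 1 ≤ p) (hn : n ≤ B) (hpB : p ≤ B) :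
    RunsIn box B weightPointP (.ofList [.elt y,
        .ofList ((List.range n).reverse.map fun i => .ofNat F (weight n p i))])
      (.ofPoint (weightPoint n p y)) := by
  have := RunsIn.push (box := box) (B := B) (e := (.ofList [.elt y,
        .ofList ((List.range n).reverse.map fun i => .ofNat F (weight n p i))]))
    (enc := fun i => .ofNat F (weight n p i)) (l := varP 1) (p := nilP)
    (q := callP powP [varP 2, varP 0]) (xs := (List.range n).reverse) (ys := [])
    (fun i => .elt (y ^ weight n p i)) (.var 1 _) (by simpa) .nil
    (fun i _ v => .call₂ (.var 2 _) (.var 0 _) (runsIn_powP ((weight_le hp n i).trans hpB)))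
  rw [List.append_nil, ← List.map_reverse, List.reverse_reverse] at this
  refine cast ?_ this
  congr 1
  simp only [Value.ofPoint, Value.ofElts, List.map_ofFn]
  congr 1
  apply List.ext_getElem <;> simp [weightPoint]

theorem runsIn_pointTableP {n R : ℕ} {Y : List F} (hn : n + 1 ≤ B) (hR : (n + 1) * R ≤ B)
    (hY : Y.length ≤ B) :
    RunsIn box B pointTableP (.ofList [.ofNat F R, .ofElts Y, .ofNat F n, .ofNat F (n + 1)])
      (.ofList ((pointTable n Y R).map .ofPoint)) := by
  have hRB : R ≤ B := le_trans (by nlinarith) hR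
  refine .tail (.foldNat (.var 0 _) hRB
    (fun j => .cons (.ofNat F (j + 1)) (.ofList ((pointTable n Y j).map .ofPoint)))
    (.fork (.num 1 _) .nil) fun j hj => ?_)
  refine .letIn (.call₃ (.head (.var 1 _)) (.var 4 _) (.var 5 _) (runsIn_weightsP (by omega) hn
    ((Nat.mul_le_mul_left _ hj).trans hR))) (.fork (.fork .nil (.head (.var 2 _))) ?_)
  have h : (pointTable n Y (j + 1)).map Value.ofPoint =
      (Y.map (Value.ofPoint ∘ weightPoint n (j + 1))).reverse ++ (pointTable n Y j).map .ofPoint :=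
    by simp [pointTable]
  rw [h]
  refine .push (enc := .elt) (Value.ofPoint ∘ weightPoint n (j + 1)) (.var 4 _) hY
    (.tail (.var 2 _)) fun y _ v => .call₂ (.var 0 _) (.var 2 _) ?_
  exact runsIn_weightPointP (by omega) (by omega) (by omega)

end

/-! ### The mapping `S` -/

section

variable {F : Type*} [Field F]

/-- The values of the switching polynomials at `z`. -/
def switchPoint {n : ℕ} (c : Fin (n + 1) → F) (z : F) (i : Fin n) : F := (switchPoly c i).eval z

/-- The program for `switchPoint`, with `z`, the reverse of the list `c` and the reverse of its tail
as arguments. -/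
def switchPointP : Prog :=
  tailP (foldP (varP 2) (.fork (.instr .zero) nilP)
    (letP (binP .add (headP (varP 1)) (callP lagrangeValP [varP 0, varP 2, varP 3]))
      (.fork (varP 0) (.fork (varP 0) (tailP (varP 2))))))

theorem lagrangeVal_ofFn_reverse {n : ℕ} {c : Fin n → F} (hc : Function.Injective c) (t : Fin n)
    (z : F) : lagrangeVal (List.ofFn c).reverse (c t) z =
      (Lagrange.basis Finset.univ c t).eval z := by
  classical
  rw [lagrangeVal, List.map_reverse, List.prod_reverse, List.map_ofFn, List.prod_ofFn,
    Lagrange.basis, Polynomial.eval_prod, ← Finset.mul_prod_erase _ _ (Finset.mem_univ t)]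
  simp only [Function.comp_apply, if_true, one_mul]
  refine Finset.prod_congr rfl fun j hj => ?_
  rw [if_neg (fun h => (Finset.ne_of_mem_erase hj) (hc h).symm)]
  simp [Lagrange.basisDivisor, mul_comm]

theorem eval_switchPoly {n : ℕ} {c : Fin (n + 1) → F} (hc : Function.Injective c) (i : Fin n)
    (z : F) : (switchPoly c i).eval z = ∑ t : Fin (n + 1),
      if (i : ℕ) < t then lagrangeVal (List.ofFn c).reverse (c t) z else 0 := by
  rw [switchPoly, Lagrange.interpolate_apply, Polynomial.eval_finsetSum]
  refine Finset.sum_congr rfl fun t _ => ?_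
  rw [lagrangeVal_ofFn_reverse hc]
  have : i.succ ≤ t ↔ (i : ℕ) < t := by
    rw [Fin.le_def, Fin.val_succ]
    omega
  simp only [this]
  split_ifs <;> simp

variable {box : Value F → F} {B : ℕ}

/-- Coordinate `i` is the sum `S i` of the Lagrange basis values for the nodes with index greater
than `i`. Running through the nodes from the last one down, the program adds one basis value per
round and pushes the partial sum, which yields the coordinates in the right order. The node `c 0`
belongs to no sum, hence the separate list of the other nodes. -/
theorem runsIn_switchPointP {n : ℕ} {c : Fin (n + 1) → F} (hc : Function.Injective c) (z : F)
    (hn : n + 1 ≤ B) :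
    RunsIn box B switchPointP (.ofList [.elt z, .ofElts (List.ofFn c).reverse,
      .ofElts (List.ofFn fun i : Fin n => c i.succ).reverse]) (.ofPoint (switchPoint c z)) := by
  set S : ℕ → F := fun i => ∑ t : Fin (n + 1),
      if i < t then lagrangeVal (List.ofFn c).reverse (c t) z else 0 with hS
  have hSn : S n = 0 := Finset.sum_eq_zero fun t _ => if_neg (by omega)
  have hSi : ∀ i : Fin n, S i = S (i + 1) + lagrangeVal (List.ofFn c).reverse (c i.succ) z := by
    intro i
    have : ∀ t : Fin (n + 1), (if (i : ℕ) < t then lagrangeVal (List.ofFn c).reverse (c t) z else 0)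
        = (if (i : ℕ) + 1 < t then lagrangeVal (List.ofFn c).reverse (c t) z else 0) +
        if t = i.succ then lagrangeVal (List.ofFn c).reverse (c t) z else 0 := by
      intro t
      have h : t = i.succ ↔ (t : ℕ) = i + 1 := by rw [Fin.ext_iff, Fin.val_succ]
      simp only [h]
      split_ifs <;> first | omega | simp
    simp only [hS, this, Finset.sum_add_distrib]
    simp
  have hw : switchPoint c z = fun i : Fin n => S i := funext fun i => eval_switchPoly hc i z
  have := RunsIn.fold (box := box) (B := B)
    (e := .ofList [.elt z, .ofElts (List.ofFn c).reverse,
      .ofElts (List.ofFn fun i : Fin n => c i.succ).reverse])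
    (xs := (List.ofFn fun i : Fin n => c i.succ).reverse.map .elt) (l := varP 2)
    (p := .fork (.instr .zero) nilP)
    (q := letP (binP .add (headP (varP 1)) (callP lagrangeValP [varP 0, varP 2, varP 3]))
      (.fork (varP 0) (.fork (varP 0) (tailP (varP 2)))))
    (.var 2 _) (by simp; omega)
    (fun j => .cons (.elt (S (n - j))) (.ofElts ((List.ofFn (switchPoint c z)).drop (n - j)))) ?_
    (fun j hj => ?_)
  · simpa [switchPointP, Value.ofPoint] using this.tail
  · rw [Nat.sub_zero, hSn, List.drop_eq_nil_of_le (by simp)]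
    exact .fork .zero .nil
  · simp only [List.length_map, List.length_reverse, List.length_ofFn] at hj
    have h := hSi ⟨n - (j + 1), by omega⟩
    simp only [show n - (j + 1) + 1 = n - j by omega] at h
    rw [List.drop_eq_getElem_cons (i := n - (j + 1)) (by simp; omega),
      show n - (j + 1) + 1 = n - j by omega, List.getElem_ofFn, hw]
    simp only [List.getElem_map, List.getElem_reverse, List.getElem_ofFn, List.length_ofFn]
    simp only [show n - 1 - j = n - (j + 1) by omega, h]
    exact .letIn (.add (.head (.var 1 _)) (.call₃ (.var 0 _) (.var 2 _) (.var 3 _)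
      (runsIn_lagrangeValP (by simpa)))) (.fork (.var 0 _) (.fork (.var 0 _) (.tail (.var 2 _))))

/-- The point that the switch `w` makes of the points `p` and `a`. -/
def switchTo {n : ℕ} (p a w : Fin n → F) (i : Fin n) : F := p i * w i + a i * (1 - w i)

/-- The program for `switchTo`. -/
def switchToP : Prog :=
  zipP (zipP (varP 0) (varP 2) (binP .mul (varP 0) (varP 1)))
    (zipP (varP 1) (varP 2) (binP .mul (varP 0) (binP .sub (.instr .one) (varP 1))))
    (binP .add (varP 0) (varP 1))

theorem runsIn_switchToP {n : ℕ} {p a w : Fin n → F} (hn : n ≤ B) :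
    RunsIn box B switchToP (.ofList [.ofPoint p, .ofPoint a, .ofPoint w])
      (.ofPoint (switchTo p a w)) :=
  .zipWith (fun x y => x + y) hn
    (.zipWith (fun x y => x * y) hn (.var 0 _) (.var 2 _) fun _ _ => .mul (.var 0 _) (.var 1 _))
    (.zipWith (fun x y => x * (1 - y)) hn (.var 1 _) (.var 2 _)
      fun _ _ => .mul (.var 0 _) (.sub .one (.var 1 _)))
    fun _ _ => .add (.var 0 _) (.var 1 _)

/-- The values of the mapping `S_k`, given the values of `L` and the values of the switches. -/
def sweep {n : ℕ} (LV WV : List (Fin n → F)) : ℕ → List (Fin n → F)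
  | 0 => [0]
  | k + 1 => ((sweep LV WV k).flatMap fun p => LV.flatMap fun a => WV.map fun w =>
      switchTo p a w).reverse

/-- The program for `sweep`, with the arguments `k`, `LV`, `WV` and the zero vector. -/
def sweepP : Prog :=
  foldP (varP 0) (listP [varP 3])
    (foldP (varP 1) nilP
      (foldP (varP 5) (varP 1)
        (pushP (varP 8) (varP 1) (callP switchToP [varP 4, varP 2, varP 0]))))

theorem length_sweep {n : ℕ} (LV WV : List (Fin n → F)) (k : ℕ) :
    (sweep LV WV k).length = (LV.length * WV.length) ^ k := by
  induction k with
  | zero => rfl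
  | succ k ih => simp [sweep, List.length_flatMap, List.map_const', ih, pow_succ]

theorem runsIn_sweepP {n k : ℕ} {LV WV : List (Fin n → F)} (hn : n ≤ B) (hk : k ≤ B)
    (hL : LV.length ≤ B) (hW : WV.length ≤ B)
    (hB : ∀ j < k, (LV.length * WV.length) ^ j ≤ B) :
    RunsIn box B sweepP (.ofList [.ofNat F k, .ofList (LV.map .ofPoint),
        .ofList (WV.map .ofPoint), .ofPoint (0 : Fin n → F)])
      (.ofList ((sweep LV WV k).map .ofPoint)) := by
  refine .foldNat (.var 0 _) hk (fun j => .ofList ((sweep LV WV j).map .ofPoint))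
    (.fork (.var 3 _) .nil) fun j hj => ?_
  have := RunsIn.flatFold (box := box) (B := B)
    (e := .cons .nil (.cons (.ofList ((sweep LV WV j).map .ofPoint))
      (.ofList [.ofNat F k, .ofList (LV.map .ofPoint), .ofList (WV.map .ofPoint),
        .ofPoint (0 : Fin n → F)])))
    (enc := .ofPoint) (l := varP 1) (p := nilP)
    (q := foldP (varP 5) (varP 1)
        (pushP (varP 8) (varP 1) (callP switchToP [varP 4, varP 2, varP 0])))
    (xs := sweep LV WV j) (ys := [])
    (fun p => LV.flatMap fun a => WV.map fun w => .ofPoint (switchTo p a w)) (.var 1 _)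
    (by rw [length_sweep]; exact hB j hj) .nil
    (fun p _ ys => .flatFold (enc := .ofPoint) _ (.var 5 _) hL (.var 1 _)
      fun a _ ys' => .push (enc := .ofPoint) _ (.var 8 _) hW (.var 1 _)
        fun w _ v => .call₃ (.var 4 _) (.var 2 _) (.var 0 _) (runsIn_switchToP hn))
  simpa [sweep, List.map_flatMap, Function.comp_def] using this

end

/-! ### The algorithm -/

/-- The number of the variables of the generator for polynomials with at most `m` monomials. -/
def numVars (n m : ℕ) : ℕ := clogAux n m + clogAux n m + 8

section

variable {F : Type*} [Field F]

/-- A hitting set for the polynomials with at most `m` monomials and of degree at most `n`. -/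
def sparseHitting (n m : ℕ) (us : List F) : List (Fin n → F) :=
  -- Moduli up to `2 n² m` are needed to separate monomials. The substituted univariate polynomial
  -- then has degree at most `n * (2 n² m)`, which is less than the number `n³ * (n² m)` of values
  -- of `y` as soon as `n ≥ 2`.
  pointTable n (us.take (n * n * n * (n * n * m))).reverse (n * n * m + n * n * m)

/-- The set `U`, as a list. -/
def sampleList (n : ℕ) (us : List F) : List F := (us.take (n * n * n + 1)).reverse

/-- The values of the generator for sparse polynomials. -/
def generatorValues (n m : ℕ) (us : List F) : List (Fin n → F) :=
  ((lagrangeTable (us.take n).reverse (sampleList n us) (numVars n m)).map fun u =>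
    dot u (sparseHitting n m us)).reverse

/-- The values of the switches. -/
def switchValues (n : ℕ) (us : List F) (c : Fin (n + 1) → F) : List (Fin n → F) :=
  ((sampleList n us).map (switchPoint c)).reverse

/-- The output of the algorithm. -/
def outputList (n k m : ℕ) (us : List F) (c : Fin (n + 1) → F) : List (Fin n → F) :=
  sweep (generatorValues n m us) (switchValues n us c) k

end

/-- The program for `numVars`, with the arguments `n` and `m`. -/
def numVarsP : Prog :=
  letP (callP clogP [varP 0, varP 1]) (callP natAddP [callP natAddP [varP 0, varP 0], numP 8])

/-- The program for `sparseHitting`, with the arguments `n`, `n * n * m` and `us`. -/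
def sparseHittingP : Prog :=
  callP pointTableP [callP natAddP [varP 1, varP 1],
    callP takeP [callP natMulP [callP natMulP [callP natMulP [varP 0, varP 0], varP 0], varP 1],
      varP 2], varP 0, .fork nilP (varP 0)]

/-- The program for `generatorValues`, whose arguments are the hitting set for sparse polynomials,
the zero vector, the grid, the set `U` and the number of the variables of the generator. -/
def generatorValuesP : Prog :=
  pushP (callP lagrangeTableP [varP 4, varP 2, varP 3]) nilP (callP dotP [varP 0, varP 2, varP 3])

/-- The program for `switchValues`, with the arguments `U`, `us` and `n`. -/
def switchValuesP : Prog :=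
  letP (callP takeP [.fork nilP (varP 2), varP 1]) <|
  letP (callP takeP [varP 3, tailP (varP 2)]) <|
  pushP (varP 2) nilP (callP switchPointP [varP 0, varP 3, varP 2])

/-- The program that lists the hitting set. -/
def algP : Prog :=
  -- In the input the list of field elements is the tail after three entries and not an entry
  -- itself. The rearranged environment is `us, n, k, s`; the following `letP` put in front of it
  -- `m`, the zero vector, `U`, the values of `L` and the values of the switches.
  .seq (.fork (.seq (.instr .tail) (.seq (.instr .tail) (.instr .tail)))
    (listP [varP 0, varP 1, varP 2])) <|
  letP (callP natPowP [varP 3, callP natAddP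
    [callP natMulP [numP 5, callP natMulP [varP 2, varP 2]], numP 2]]) <|
  letP (callP zeroP [varP 2]) <|
  letP (callP takeP [.fork nilP (callP natMulP [callP natMulP [varP 3, varP 3], varP 3]), varP 2]) <|
  letP (callP generatorValuesP
    [callP sparseHittingP [varP 4, callP natMulP [callP natMulP [varP 4, varP 4], varP 2], varP 3],
      varP 1, callP takeP [varP 4, varP 3], varP 0, callP numVarsP [varP 4, varP 2]]) <|
  letP (callP switchValuesP [varP 1, varP 4, varP 5]) <|
  callP sweepP [varP 7, varP 1, varP 0, varP 3]

/-- The program for the identity test. -/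
def testP : Prog :=
  foldP algP (numP 1) (.cond (unP .isZero (unP .query (varP 0))) (varP 1) nilP)

/-- The two logarithms in `numVars` pay for `m ^ 2` and the summand `8` pays for `n ^ 8`. So `n ^ 8
* m ^ 2`, which bounds the number of points to be interpolated, fits into the grid, and so do all
the auxiliary quantities of the algorithm. -/
theorem monomial_le_pow_numVars {n m i j : ℕ} (hn : 2 ≤ n) (hm : 1 ≤ m) (hi : i ≤ 8) (hj : j ≤ 2) :
    n ^ i * m ^ j ≤ n ^ numVars n m := by
  rw [numVars, pow_add, pow_add, mul_comm]
  refine Nat.mul_le_mul ((Nat.pow_le_pow_right hm hj).trans ?_)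
    (Nat.pow_le_pow_right (by omega) hi)
  rw [pow_two]
  exact Nat.mul_le_mul (le_pow_clogAux hn hm) (le_pow_clogAux hn hm)

theorem pow_numVars_le {n m : ℕ} (hn : 2 ≤ n) (hm : 1 ≤ m) :
    n ^ numVars n m ≤ n ^ 10 * m ^ 2 := by
  rw [numVars, pow_add, pow_add]
  calc n ^ clogAux n m * n ^ clogAux n m * n ^ 8 ≤ (n * m) * (n * m) * n ^ 8 :=
        Nat.mul_le_mul_right _ (Nat.mul_le_mul (pow_clogAux_le hn hm) (pow_clogAux_le hn hm))
    _ = n ^ 10 * m ^ 2 := by ring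

/-! ### Sizes of the lists and correctness of the algorithm -/

section

variable {F : Type*} [Field F]

theorem length_sparseHitting_le {n m : ℕ} (hn : 2 ≤ n) (hm : 1 ≤ m) (us : List F) :
    (sparseHitting n m us).length ≤ n ^ numVars n m := by
  rw [sparseHitting, length_pointTable, List.length_reverse, List.length_take]
  calc _ ≤ (n * n * m + n * n * m) * (n * n * n * (n * n * m)) :=
        Nat.mul_le_mul_left _ (min_le_left _ _)
    _ = 2 * (n ^ 7 * m ^ 2) := by ring
    _ ≤ n * (n ^ 7 * m ^ 2) := Nat.mul_le_mul_right _ hn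
    _ = n ^ 8 * m ^ 2 := by ring
    _ ≤ _ := monomial_le_pow_numVars hn hm le_rfl le_rfl

theorem length_generatorValues (n m : ℕ) (us : List F) :
    (generatorValues n m us).length = (sampleList n us).length ^ numVars n m := by
  simp [generatorValues, length_lagrangeTable]

theorem length_outputList (n k m : ℕ) (us : List F) (c : Fin (n + 1) → F) :
    (outputList n k m us c).length = ((sampleList n us).length ^ (numVars n m + 1)) ^ k := by
  rw [outputList, length_sweep, length_generatorValues, switchValues, List.length_reverse,
    List.length_map, pow_succ]

variable {box : Value F → F} {B : ℕ}

theorem runsIn_numVarsP {n m : ℕ} (hn : 2 ≤ n) (hm : 1 ≤ m) (hB : n * m ≤ B)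
    (hq : numVars n m ≤ B) :
    RunsIn box B numVarsP (.ofList [.ofNat F n, .ofNat F m]) (.ofNat F (numVars n m)) := by
  have : clogAux n m + clogAux n m + 8 ≤ B := hq
  exact .letIn (.call₂ (.var 0 _) (.var 1 _) (runsIn_clogP hn hm hB))
    (.call₂ (.call₂ (.var 0 _) (.var 0 _) (runsIn_natAddP (by omega))) (.num 8 _)
      (runsIn_natAddP (by omega)))

theorem runsIn_sparseHittingP {n m : ℕ} {us : List F} (hn : 2 ≤ n)
    (hus : n * n * n * (n * n * m) ≤ us.length) (hn3 : n * n * n + 1 ≤ B)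
    (hY : n * n * n * (n * n * m) ≤ B) (hR : (n + 1) * (n * n * m + n * n * m) ≤ B) :
    RunsIn box B sparseHittingP (.ofList [.ofNat F n, .ofNat F (n * n * m), .ofElts us])
      (.ofList ((sparseHitting n m us).map .ofPoint)) := by
  have h1 : n * n ≤ n * n * n := Nat.le_mul_of_pos_right _ (by omega)
  have h2 : n * 2 ≤ n * n := Nat.mul_le_mul_left _ hn
  have hX : n * n * m ≤ B := le_trans (Nat.le_mul_of_pos_left _ (by positivity)) hY
  have hlen : (us.take (n * n * n * (n * n * m))).reverse.length ≤ B := by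
    rw [List.length_reverse, List.length_take]
    omega
  refine .seq (.fork (.call₂ (.var 1 _) (.var 1 _) (runsIn_natAddP hX)) (.fork (.call₂ (.call₂
    (.call₂ (.call₂ (.var 0 _) (.var 0 _) (runsIn_natMulP ?_ ?_)) (.var 0 _) (runsIn_natMulP ?_ ?_))
    (.var 1 _) (runsIn_natMulP ?_ hX)) (.var 2 _) (runsIn_takeP (us := us) hY hus))
    (.fork (.var 0 _) (.fork (.fork .nil (.var 0 _)) .nil))))
    (runsIn_pointTableP (n := n) (by omega) hR hlen) <;> omega

theorem runsIn_generatorValuesP {n m : ℕ} {us : List F} (hn : 2 ≤ n) (hm : 1 ≤ m)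
    (hn3 : n * n * n + 1 ≤ B) (hus : n * n * n + 1 ≤ us.length)
    (hq : numVars n m ≤ B) (hW : n ^ numVars n m ≤ B) (hU : (n * n * n + 1) ^ numVars n m ≤ B) :
    RunsIn box B generatorValuesP (.ofList [.ofList ((sparseHitting n m us).map .ofPoint),
      .ofPoint (0 : Fin n → F), .ofElts (us.take n).reverse, .ofElts (sampleList n us),
      .ofNat F (numVars n m)]) (.ofList ((generatorValues n m us).map .ofPoint)) := by
  have h1 : n * n ≤ n * n * n := Nat.le_mul_of_pos_right _ (by omega)
  have h2 : n * 2 ≤ n * n := Nat.mul_le_mul_left _ hn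
  have hlU : (sampleList n us).length = n * n * n + 1 := by simp [sampleList, hus]
  have hlW : (us.take n).reverse.length = n := by
    rw [List.length_reverse, List.length_take]
    omega
  have hl := length_sparseHitting_le hn hm us
  have := RunsIn.push (box := box) (B := B) (l := callP lagrangeTableP [varP 4, varP 2, varP 3])
    (p := nilP)
    (q := callP dotP [varP 0, varP 2, varP 3]) (enc := .ofElts) (ys := [])
    (xs := lagrangeTable (us.take n).reverse (sampleList n us) (numVars n m))
    (e := .ofList [.ofList ((sparseHitting n m us).map .ofPoint),
      .ofPoint (0 : Fin n → F), .ofElts (us.take n).reverse, .ofElts (sampleList n us),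
      .ofNat F (numVars n m)])
    (fun u => .ofPoint (dot u (sparseHitting n m us)))
    (.call₃ (.var 4 _) (.var 2 _) (.var 3 _) (runsIn_lagrangeTableP hq (by omega) (by omega)
      (fun j hj => ?_) fun j hj => ?_))
    (by rw [length_lagrangeTable, hlU]; exact hU) .nil fun u hu v =>
      .call₃ (.var 0 _) (.var 2 _) (.var 3 _) (runsIn_dotP (n := n) (by omega) (hl.trans hW)
        (by rw [length_of_mem_lagrangeTable hu, hlW]; exact hl))
  · simpa [generatorValuesP, generatorValues, Function.comp_def] using this
  · rw [hlW]
    exact (Nat.pow_le_pow_right (by omega) hj.le).trans hW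
  · rw [hlU]
    exact (Nat.pow_le_pow_right (by omega) hj.le).trans hU

theorem runsIn_switchValuesP {n : ℕ} {us : List F} {c : Fin (n + 1) → F}
    (hc : Function.Injective c) (hcus : ∀ j : Fin (n + 1), us[(j : ℕ)]? = some (c j))
    (hn : n * n * n + 1 ≤ B) (hnB : n + 1 ≤ B) (hus : n + 1 ≤ us.length) :
    RunsIn box B switchValuesP (.ofList [.ofElts (sampleList n us), .ofElts us, .ofNat F n])
      (.ofList ((switchValues n us c).map .ofPoint)) := by
  have hC : us.take (n + 1) = List.ofFn c := by
    refine List.ext_getElem? fun i => ?_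
    rw [List.getElem?_take, List.getElem?_ofFn]
    split_ifs with h
    · exact hcus ⟨i, h⟩
    · rfl
  have hCt : us.tail.take n = List.ofFn fun i : Fin n => c i.succ := by
    rw [List.ofFn_succ] at hC
    cases us with
    | nil => simp at hC
    | cons x us => simpa using (List.cons.inj hC).2
  refine .letIn (v := .ofElts (List.ofFn c).reverse) ?_
    (.letIn (v := .ofElts (List.ofFn fun i : Fin n => c i.succ).reverse) ?_ ?_)
  · rw [← hC]
    exact .call₂ (.fork .nil (.var 2 _)) (.var 1 _) (runsIn_takeP (us := us) hnB hus)
  · rw [← hCt]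
    refine .call₂ (.var 3 _) (.tail_ofList (xs := us.map .elt) (.var 2 _)) ?_
    rw [← List.map_tail]
    exact runsIn_takeP (us := us.tail) (by omega) (by simp; omega)
  · have := RunsIn.push (box := box) (B := B) (l := varP 2) (p := nilP)
      (q := callP switchPointP [varP 0, varP 3, varP 2]) (enc := .elt) (ys := [])
      (e := .ofList [.ofElts (List.ofFn fun i : Fin n => c i.succ).reverse,
        .ofElts (List.ofFn c).reverse, .ofElts (sampleList n us), .ofElts us, .ofNat F n])
      (xs := sampleList n us) (fun z => .ofPoint (switchPoint c z)) (.var 2 _)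
      (by simp [sampleList]; omega) .nil fun z hz v =>
        .call₃ (.var 0 _) (.var 3 _) (.var 2 _) (runsIn_switchPointP hc z hnB)
    refine cast ?_ this
    simp [switchValues, Function.comp_def, Value.ofList]

/-- The bound `B` dominates the length of the final list, and every other loop is at most as long:
the intermediate numbers are controlled by monomials in `n` and `m` below `n ^ numVars n m`, or by
powers of `|U|` with smaller exponents. The black box is arbitrary, since no query is made. -/
theorem runsIn_algP {n k s m : ℕ} (hn : 2 ≤ n) (hk : 1 ≤ k) (hs : 2 ≤ s)
    (hm : m = s ^ (5 * (k * k) + 2)) {us : List F} (hus : n * n * n * (n * n * m) ≤ us.length)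
    {c : Fin (n + 1) → F} (hc : Function.Injective c)
    (hcus : ∀ j : Fin (n + 1), us[(j : ℕ)]? = some (c j))
    (hB : ((n * n * n + 1) ^ (numVars n m + 1)) ^ k ≤ B) :
    RunsIn box B algP (.input n k s us) (.ofList ((outputList n k m us c).map .ofPoint)) := by
  have hm1 : 1 ≤ m := by
    rw [hm]
    exact Nat.one_le_pow _ _ (by omega)
  have hn4 : 2 * 2 ≤ n * n := Nat.mul_le_mul hn hn
  have hn8 : 2 * (n * n) ≤ n * n * n := by
    rw [mul_comm 2]
    exact Nat.mul_le_mul_left _ hn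
  have hn5 : 2 * n ≤ n * n := Nat.mul_le_mul_right _ hn
  have hB₁ : (n * n * n + 1) ^ (numVars n m + 1) ≤ B :=
    (Nat.le_self_pow (by omega) _).trans hB
  have hB₂ : (n * n * n + 1) ^ numVars n m ≤ B :=
    (Nat.pow_le_pow_right (by omega) (by omega)).trans hB₁
  have hB₃ : n ^ numVars n m ≤ B := (Nat.pow_le_pow_left (by omega) _).trans hB₂
  have hmon : ∀ i ≤ 8, ∀ j ≤ 2, n ^ i * m ^ j ≤ B :=
    fun i hi j hj => (monomial_le_pow_numVars hn hm1 hi hj).trans hB₃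
  have hnB : n * n * n + 1 ≤ B := (Nat.le_self_pow (by omega) _).trans hB₁
  have hmB : m ≤ B := by simpa using hmon 0 (by norm_num) 1 (by norm_num)
  have hnm : n * m ≤ B := by simpa using hmon 1 (by norm_num) 1 (by norm_num)
  have hY : n * n * n * (n * n * m) ≤ B := by
    refine le_of_eq_of_le ?_ (hmon 5 (by norm_num) 1 (by norm_num))
    ring
  have hR : (n + 1) * (n * n * m + n * n * m) ≤ B := by
    refine le_trans ?_ hY
    calc (n + 1) * (n * n * m + n * n * m) = (2 * n + 2) * (n * n * m) := by ring
      _ ≤ _ := Nat.mul_le_mul_right _ (by omega)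
  have hq : numVars n m ≤ B := (Nat.lt_pow_self (by omega)).le.trans hB₃
  -- An exponent is less than the power it produces, here `m`.
  have hexp : 5 * (k * k) + 2 ≤ B := (Nat.lt_pow_self (show 1 < s by omega)).le.trans (hm ▸ hmB)
  have hsB : s ≤ B := le_trans (hm ▸ Nat.le_self_pow (by omega) s) hmB
  have hkk : k ≤ k * k := Nat.le_mul_self k
  have hlen : n * n * n + 1 ≤ us.length := by
    have : 2 * 2 * 1 ≤ n * n * m := Nat.mul_le_mul hn4 hm1
    have := Nat.mul_le_mul_left (n * n * n) this
    omega
  have hU : (sampleList n us).length = n * n * n + 1 := by simp [sampleList, hlen]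
  refine .seq (y := .ofList [.ofElts us, .ofNat F n, .ofNat F k, .ofNat F s])
    (.fork (.seq (.instr _ _) (.seq (.instr _ _) (.instr _ _)))
    (.fork (.var 0 _) (.fork (.var 1 _) (.fork (.var 2 _) .nil)))) ?_
  refine .letIn (v := .ofNat F m) ?_ ?_
  · rw [hm]
    exact .call₂ (.var 3 _) (.call₂ (.call₂ (.num 5 _) (.call₂ (.var 2 _) (.var 2 _)
      (runsIn_natMulP (by omega) (by omega))) (runsIn_natMulP (by omega) (by omega))) (.num 2 _)
      (runsIn_natAddP (by omega))) (runsIn_natPowP hsB hexp (hm ▸ hmB))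
  clear hm
  refine .letIn (v := .ofPoint (0 : Fin n → F)) (.call₁ (.var 2 _) (runsIn_zeroP (by omega))) ?_
  refine .letIn (v := .ofElts (sampleList n us)) (.call₂ (.fork .nil (.call₂ (.call₂ (.var 3 _)
    (.var 3 _) (runsIn_natMulP (by omega) (by omega))) (.var 3 _)
    (runsIn_natMulP (by omega) (by omega)))) (.var 2 _) (runsIn_takeP (us := us) hnB hlen)) ?_
  refine .letIn (v := .ofList ((generatorValues n m us).map .ofPoint)) (.seq (.fork
    (.call₃ (.var 4 _) (.call₂ (.call₂ (.var 4 _) (.var 4 _) (runsIn_natMulP (by omega) (by omega)))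
      (.var 2 _) (runsIn_natMulP (by omega) hmB)) (.var 3 _)
      (runsIn_sparseHittingP (us := us) hn hus hnB hY hR))
    (.fork (.var 1 _) (.fork (.call₂ (.var 4 _) (.var 3 _)
      (runsIn_takeP (us := us) (by omega) (by omega)))
    (.fork (.var 0 _) (.fork (.call₂ (.var 4 _) (.var 2 _)
      (runsIn_numVarsP hn hm1 hnm hq)) .nil)))))
    (runsIn_generatorValuesP hn hm1 hnB hlen hq hB₃ hB₂)) ?_
  refine .letIn (v := .ofList ((switchValues n us c).map .ofPoint)) (.call₃ (.var 1 _) (.var 4 _)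
    (.var 5 _) (runsIn_switchValuesP hc hcus hnB (by omega) (by omega))) ?_
  have hLl : (generatorValues n m us).length ≤ B := by
    rw [length_generatorValues, hU]
    exact hB₂
  have hWl : (switchValues n us c).length = n * n * n + 1 := by
    rw [switchValues, List.length_reverse, List.length_map, hU]
  have hs := runsIn_sweepP (box := box) (B := B) (n := n) (k := k) (LV := generatorValues n m us)
    (WV := switchValues n us c) (by omega) (by omega) hLl (by omega) fun j hj => by
      rw [length_generatorValues, hWl, hU, ← pow_succ]
      exact (Nat.pow_le_pow_right (Nat.one_le_pow _ _ (by omega)) hj.le).trans hB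
  unfold outputList
  generalize generatorValues n m us = LV at hs ⊢
  generalize switchValues n us c = WV at hs ⊢
  exact .seq (.fork (.var 7 _) (.fork (.var 1 _) (.fork (.var 0 _) (.fork (.var 3 _) .nil)))) hs

end

/-! ### The mapping `S` over an algebra -/

section

variable {F : Type*} [Field F] {R : Type*} [CommRing R] [Algebra F R] {n q : ℕ}

/-- The mapping `S_l` over an `F`-algebra. -/
def genSAlg (L : Fin n → MvPolynomial (Fin q) F) (c : Fin (n + 1) → F) :
    (l : ℕ) → (Fin l → Fin q → R) → (Fin l → R) → Fin n → R
  | 0, _, _, _ => 0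
  | l + 1, y, z, i =>
    genSAlg L c l (Fin.init y) (Fin.init z) i * Polynomial.aeval (z (Fin.last l)) (switchPoly c i) +
      MvPolynomial.aeval (y (Fin.last l)) (L i) *
        (1 - Polynomial.aeval (z (Fin.last l)) (switchPoly c i))

theorem genS_eq_genSAlg (L : Fin n → MvPolynomial (Fin q) F) (c : Fin (n + 1) → F) (l : ℕ)
    (y : Fin l → Fin q → F) (z : Fin l → F) : genS L c l y z = genSAlg L c l y z := by
  induction l with
  | zero => rfl
  | succ l ih =>
    funext i
    simp [genS, genSAlg, ih, MvPolynomial.aeval_eq_eval]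

/-- Naturality: the mapping with generic variables specializes both to points over `F` and to points
over the algebraic closure. This carries nonvanishing from the closure to a polynomial over `F`. -/
theorem map_genSAlg {S : Type*} [CommRing S] [Algebra F S] (φ : R →ₐ[F] S)
    (L : Fin n → MvPolynomial (Fin q) F) (c : Fin (n + 1) → F) (l : ℕ)
    (y : Fin l → Fin q → R) (z : Fin l → R) (i : Fin n) :
    φ (genSAlg L c l y z i) = genSAlg L c l (fun a b => φ (y a b)) (fun a => φ (z a)) i := by
  induction l with
  | zero => simp [genSAlg]
  | succ l ih =>
    simp only [genSAlg, map_add, map_mul, map_sub, map_one, ih, Polynomial.aeval_algHom_apply,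
      ← MvPolynomial.comp_aeval_apply]
    rfl

theorem aeval_switchPoly {c : Fin (n + 1) → F} (hc : Function.Injective c) (i : Fin n)
    (j : Fin (n + 1)) : Polynomial.aeval (algebraMap F R (c j)) (switchPoly c i) =
      if (i : ℕ) < j then 1 else 0 := by
  rw [Polynomial.aeval_algebraMap_apply, Polynomial.aeval_def, Algebra.algebraMap_self,
    Polynomial.eval₂_id, switchPoly,
    Lagrange.eval_interpolate_at_node _ hc.injOn (Finset.mem_univ j)]
  have : i.succ ≤ j ↔ (i : ℕ) < j := by
    rw [Fin.le_def, Fin.val_succ]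
    omega
  simp only [this]
  split_ifs <;> simp

/-- Switching at `c j` keeps the first `j` coordinates and takes the others from `L`. -/
theorem genSAlg_snoc {L : Fin n → MvPolynomial (Fin q) F} {c : Fin (n + 1) → F}
    (hc : Function.Injective c) {l : ℕ} (y : Fin l → Fin q → R) (z : Fin l → R) (y₀ : Fin q → R)
    (j : Fin (n + 1)) (i : Fin n) :
    genSAlg L c (l + 1) (Fin.snoc (α := fun _ => Fin q → R) y y₀)
        (Fin.snoc (α := fun _ => R) z (algebraMap F R (c j))) i =
      if (i : ℕ) < j then genSAlg L c l y z i else MvPolynomial.aeval y₀ (L i) := by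
  rw [genSAlg, Fin.snoc_last, Fin.snoc_last, Fin.init_snoc, Fin.init_snoc, aeval_switchPoly hc]
  split_ifs <;> simp

end

/-! ### The mapping `S` hits sums of products of univariate polynomials -/

theorem exists_eq_sum_succAbove {K V : Type*} [Field K] [AddCommGroup V] [Module K V] {k : ℕ}
    {v : Fin (k + 1) → V} (hv : ¬ LinearIndependent K v) :
    ∃ (i₀ : Fin (k + 1)) (g : Fin k → K), v i₀ = ∑ i, g i • v (i₀.succAbove i) := by
  obtain ⟨g, hg, i₀, hi₀⟩ := Fintype.not_linearIndependent_iff.1 hv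
  refine ⟨i₀, fun i => -(g i₀)⁻¹ * g (i₀.succAbove i), ?_⟩
  rw [Fin.sum_univ_succAbove _ i₀] at hg
  simp only [mul_smul, ← Finset.smul_sum]
  rw [eq_neg_of_add_eq_zero_right hg, smul_neg, neg_smul, neg_neg, smul_smul,
    inv_mul_cancel₀ hi₀, one_smul]

section

variable {K : Type*} [Field K] {n k : ℕ}

/-- The product of the first `j` factors of `∏ l, f l (x l)`. -/
def prefixProd (f : Fin n → Polynomial K) (j : ℕ) (x : Fin n → K) : K :=
  ∏ l : Fin n, if (l : ℕ) < j then (f l).eval (x l) else 1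

theorem prefixProd_zero (f : Fin n → Polynomial K) : prefixProd f 0 = 1 := by
  funext x
  simp [prefixProd]

theorem prefixProd_succ (f : Fin n → Polynomial K) (j : Fin n) (x : Fin n → K) :
    prefixProd f (j + 1) x = prefixProd f j x * (f j).eval (x j) := by
  unfold prefixProd
  rw [← Finset.mul_prod_erase Finset.univ _ (Finset.mem_univ j),
    ← Finset.mul_prod_erase Finset.univ (fun l : Fin n => if (l : ℕ) < j then _ else _)
      (Finset.mem_univ j)]
  simp only [lt_add_iff_pos_right, zero_lt_one, if_true, lt_irrefl, if_false, one_mul]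
  rw [mul_comm]
  congr 1
  refine Finset.prod_congr rfl fun l hl => ?_
  have : (l : ℕ) ≠ j := fun h => Finset.ne_of_mem_erase hl (Fin.ext h)
  congr 1
  simp only [eq_iff_iff]
  omega

theorem prefixProd_last (f : Fin n → Polynomial K) (x : Fin n → K) :
    prefixProd f n x = ∏ l, (f l).eval (x l) := by
  simp [prefixProd]

variable {F : Type*} [Field F] [Algebra F K] {q : ℕ}

/-- The product of all the composed factors is a nonzero polynomial, so it does not vanish
identically on the infinite field `K`. -/
theorem exists_aeval_forall_ne_zero [Infinite K] {L : Fin n → MvPolynomial (Fin q) F}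
    (hL : ∀ l (p : Polynomial K), p ≠ 0 →
      Polynomial.aeval (MvPolynomial.map (algebraMap F K) (L l)) p ≠ 0)
    {f : Fin k → Fin n → Polynomial K} (hf : ∀ i l, f i l ≠ 0) :
    ∃ y₀ : Fin q → K, ∀ i l, (f i l).eval (MvPolynomial.aeval y₀ (L l)) ≠ 0 := by
  have h : ∏ i, ∏ l, Polynomial.aeval (MvPolynomial.map (algebraMap F K) (L l)) (f i l) ≠ 0 :=
    Finset.prod_ne_zero_iff.2 fun i _ => Finset.prod_ne_zero_iff.2 fun l _ => hL l _ (hf i l)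
  obtain ⟨y₀, hy₀⟩ : ∃ y₀, MvPolynomial.eval y₀ (∏ i, ∏ l,
      Polynomial.aeval (MvPolynomial.map (algebraMap F K) (L l)) (f i l)) ≠ 0 := by
    by_contra! h'
    exact h (MvPolynomial.funext fun y => by rw [h' y, map_zero])
  refine ⟨y₀, fun i l => ?_⟩
  simp only [map_prod, Finset.prod_ne_zero_iff] at hy₀
  have := hy₀ i (Finset.mem_univ _) l (Finset.mem_univ _)
  rw [← MvPolynomial.aeval_eq_eval, ← Polynomial.aeval_algHom_apply,
    MvPolynomial.aeval_eq_eval] at this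
  simpa [MvPolynomial.aeval_def, MvPolynomial.eval_map] using this

/-- The factors are arbitrary univariate polynomials, so the class is closed under merging two
factors in the same variable, which is what lowers `k`. The scalars `a i` absorb the coefficients of
a linear dependence between whole products. -/
theorem exists_genSAlg_ne_zero [Infinite K] {L : Fin n → MvPolynomial (Fin q) F}
    (hL : ∀ l (p : Polynomial K), p ≠ 0 →
      Polynomial.aeval (MvPolynomial.map (algebraMap F K) (L l)) p ≠ 0)
    {c : Fin (n + 1) → F} (hc : Function.Injective c) (a : Fin k → K)
    (f : Fin k → Fin n → Polynomial K) (x : Fin n → K)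
    (h : ∑ i, a i * ∏ l, (f i l).eval (x l) ≠ 0) :
    ∃ (y : Fin k → Fin q → K) (z : Fin k → K),
      ∑ i, a i * ∏ l, (f i l).eval (genSAlg L c k y z l) ≠ 0 := by
  classical
  induction k generalizing x with
  | zero => simp at h
  | succ k ih =>
    by_cases hn : LinearIndependent K fun i => prefixProd (f i) n
    · have hfne : ∀ i l, f i l ≠ 0 := by
        intro i l hil
        refine hn.ne_zero i (funext fun x => ?_)
        rw [prefixProd_last]
        exact Finset.prod_eq_zero (Finset.mem_univ l) (by simp [hil])
      obtain ⟨y₀, hy₀⟩ := exists_aeval_forall_ne_zero hL hfne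
      -- The least `j` serves twice: independence at `j` allows freezing the coordinates from `j`
      -- on, and dependence at `j - 1` allows eliminating a product.
      have hex : ∃ j, LinearIndependent K fun i => prefixProd (f i) j := ⟨n, hn⟩
      have hj := Nat.find_spec hex
      have hjn : Nat.find hex ≤ n := Nat.find_min' hex hn
      have hmin : ∀ j < Nat.find hex, ¬ LinearIndependent K fun i => prefixProd (f i) j :=
        fun j => Nat.find_min hex
      generalize Nat.find hex = j at hj hjn hmin
      -- The coefficients that the prefix products receive once the coordinates from `j` on are
      -- frozen at `L (y₀)`. They are not all zero, because `y₀` avoids the zeros of every factor.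
      set b : Fin (k + 1) → K := fun i =>
        a i * ∏ l : Fin n, if (l : ℕ) < j then 1 else (f i l).eval (MvPolynomial.aeval y₀ (L l))
      have hb : ∃ i, b i ≠ 0 := by
        obtain ⟨i, -, hi⟩ := Finset.exists_ne_zero_of_sum_ne_zero h
        refine ⟨i, mul_ne_zero (left_ne_zero_of_mul hi) (Finset.prod_ne_zero_iff.2 fun l _ => ?_)⟩
        split_ifs
        · exact one_ne_zero
        · exact hy₀ i l
      obtain ⟨x₁, hx₁⟩ : ∃ x₁, ∑ i, b i * prefixProd (f i) j x₁ ≠ 0 := by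
        by_contra! h'
        obtain ⟨i, hi⟩ := hb
        refine hi (Fintype.linearIndependent_iff.1 hj b (funext fun x₁ => ?_) i)
        simpa using h' x₁
      have hS : ∀ (y : Fin k → Fin q → K) (z : Fin k → K),
          ∑ i, b i * prefixProd (f i) j (genSAlg L c k y z) ≠ 0 →
          ∃ (y : Fin (k + 1) → Fin q → K) (z : Fin (k + 1) → K),
            ∑ i, a i * ∏ l, (f i l).eval (genSAlg L c (k + 1) y z l) ≠ 0 := by
        intro y z hyz
        refine ⟨Fin.snoc (α := fun _ => Fin q → K) y y₀, Fin.snoc (α := fun _ => K) z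
          (algebraMap F K (c ⟨j, by omega⟩)), ?_⟩
        refine fun h' => hyz (Eq.trans (Finset.sum_congr rfl fun i _ => ?_) h')
        simp only [b, prefixProd, mul_assoc, ← Finset.prod_mul_distrib]
        congr 1
        refine Finset.prod_congr rfl fun l _ => ?_
        rw [genSAlg_snoc hc]
        simp only
        split_ifs <;> simp
      cases j with
      | zero =>
        -- All the prefixes are `1` here, so the sum does not depend on the point and any arguments
        -- will do.
        refine hS 0 0 ?_
        simpa [prefixProd_zero] using hx₁
      | succ j =>
        obtain ⟨i₀, g, hg⟩ := exists_eq_sum_succAbove (hmin j (by omega))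
        set j' : Fin n := ⟨j, by omega⟩
        -- The prefix of length `j` of product `i₀` is replaced by the combination of the others; in
        -- each remaining product this changes only the factor in the variable `j'`.
        set f' : Fin k → Fin n → Polynomial K := fun i l =>
          if (l : ℕ) < j then f (i₀.succAbove i) l else if l = j' then
            Polynomial.C (b (i₀.succAbove i)) * f (i₀.succAbove i) j' +
              Polynomial.C (b i₀ * g i) * f i₀ j'
          else 1 with hf'
        have hprod : ∀ i (x : Fin n → K), ∏ l, (f' i l).eval (x l) =
            prefixProd (f (i₀.succAbove i)) j x * (b (i₀.succAbove i) *
              (f (i₀.succAbove i) j').eval (x j') + b i₀ * g i * (f i₀ j').eval (x j')) := by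
          intro i x
          rw [prefixProd, ← Finset.mul_prod_erase Finset.univ _ (Finset.mem_univ j'),
            ← Finset.mul_prod_erase Finset.univ (fun l : Fin n => if (l : ℕ) < j then _ else _)
            (Finset.mem_univ j')]
          have h1 : (f' i j').eval (x j') = b (i₀.succAbove i) *
              (f (i₀.succAbove i) j').eval (x j') + b i₀ * g i * (f i₀ j').eval (x j') := by
            simp [hf', j']
          rw [h1, if_neg (by simp [j']), one_mul, mul_comm]
          congr 1
          refine Finset.prod_congr rfl fun l hl => ?_
          simp only [hf', Finset.ne_of_mem_erase hl, if_false]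
          split_ifs <;> simp
        have hsum : ∀ x : Fin n → K, ∑ i, (1 : K) * ∏ l, (f' i l).eval (x l) =
            ∑ i, b i * prefixProd (f i) (j + 1) x := by
          intro x
          have hgx : prefixProd (f i₀) j x = ∑ i, g i * prefixProd (f (i₀.succAbove i)) j x := by
            simpa using congrFun hg x
          have hsucc : ∀ i, prefixProd (f i) (j + 1) x =
            prefixProd (f i) j x * (f i j').eval (x j') := fun i => prefixProd_succ (f i) j' x
          rw [Fin.sum_univ_succAbove _ i₀]
          simp only [hprod, hsucc, hgx, one_mul, Finset.sum_mul, Finset.mul_sum,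
            ← Finset.sum_add_distrib]
          exact Finset.sum_congr rfl fun i _ => by ring
        obtain ⟨y, z, hyz⟩ := ih (fun _ => 1) f' x₁ (by rwa [hsum])
        exact hS y z (by rwa [← hsum])
    · obtain ⟨i₀, g, hg⟩ := exists_eq_sum_succAbove hn
      have hsum : ∀ x : Fin n → K, ∑ i, (a (i₀.succAbove i) + a i₀ * g i) *
          ∏ l, (f (i₀.succAbove i) l).eval (x l) = ∑ i, a i * ∏ l, (f i l).eval (x l) := by
        intro x
        have hgx := congrFun hg x
        simp only [Finset.sum_apply, Pi.smul_apply, prefixProd_last, smul_eq_mul] at hgx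
        rw [Fin.sum_univ_succAbove _ i₀, hgx, Finset.mul_sum, ← Finset.sum_add_distrib]
        exact Finset.sum_congr rfl fun i _ => by ring
      obtain ⟨y, z, hyz⟩ := ih _ (fun i => f (i₀.succAbove i)) x (by rwa [hsum])
      -- The switch at the last node keeps all the coordinates, so the new block of variables may be
      -- `0`.
      refine ⟨Fin.snoc (α := fun _ => Fin q → K) y 0, Fin.snoc (α := fun _ => K) z
          (algebraMap F K (c (Fin.last n))), ?_⟩
      have : genSAlg L c (k + 1) (Fin.snoc (α := fun _ => Fin q → K) y 0)
          (Fin.snoc (α := fun _ => K) z (algebraMap F K (c (Fin.last n)))) = genSAlg L c k y z := by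
        funext l
        rw [genSAlg_snoc hc, if_pos (by simp)]
      rwa [this, ← hsum]

end

/-! ### Degrees -/

section

open MvPolynomial

variable {F σ τ : Type*} [Field F]

theorem degreeOf_bind₁_le [Fintype τ] (G : τ → MvPolynomial σ F) (P : MvPolynomial τ F) (v : σ)
    (D : ℕ) (h : ∀ e ∈ P.support, ∑ j, e j * degreeOf v (G j) ≤ D) :
    degreeOf v (bind₁ G P) ≤ D := by
  rw [← aeval_eq_bind₁, aeval_def, eval₂_eq']
  refine (degreeOf_sum_le _ _ _).trans (Finset.sup_le fun e he => ?_)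
  refine (degreeOf_C_mul_le _ _ _).trans ((degreeOf_prod_le _ _ _).trans (le_trans ?_ (h e he)))
  exact Finset.sum_le_sum fun j _ => degreeOf_pow_le _ _ _

theorem degreeOf_polynomial_aeval_le (p : Polynomial F) (y : MvPolynomial σ F) (v : σ) :
    degreeOf v (Polynomial.aeval y p) ≤ p.natDegree * degreeOf v y := by
  rw [Polynomial.aeval_eq_sum_range]
  refine (degreeOf_sum_le _ _ _).trans (Finset.sup_le fun e he => ?_)
  rw [smul_eq_C_mul]
  refine (degreeOf_C_mul_le _ _ _).trans ((degreeOf_pow_le _ _ _).trans ?_)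
  exact Nat.mul_le_mul_right _ (by simpa [Nat.lt_succ_iff] using he)

theorem natDegree_switchPoly_le {n : ℕ} {c : Fin (n + 1) → F} (hc : Function.Injective c)
    (i : Fin n) : (switchPoly c i).natDegree ≤ n := by
  refine Polynomial.natDegree_le_of_degree_le ?_
  have := Lagrange.degree_interpolate_le (s := Finset.univ) (v := c)
    (fun j => if i.succ ≤ j then (1 : F) else 0) hc.injOn
  simpa [switchPoly] using this

variable {n q : ℕ}

/-- Degrees add up over the arguments, and each argument enters at a single level through a
polynomial of individual degree at most `n`. Distinct variables as arguments make the sum in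
parentheses `1`, so each variable has degree at most `n`. -/
theorem degreeOf_genSAlg_le {L : Fin n → MvPolynomial (Fin q) F}
    (hL : ∀ i j, (L i).degreeOf j ≤ n - 1) {c : Fin (n + 1) → F} (hc : Function.Injective c)
    (l : ℕ) (y : Fin l → Fin q → MvPolynomial σ F) (z : Fin l → MvPolynomial σ F) (i : Fin n)
    (v : σ) : degreeOf v (genSAlg L c l y z i) ≤
      n * (∑ a, ∑ b, degreeOf v (y a b) + ∑ a, degreeOf v (z a)) := by
  induction l with
  | zero => simp [genSAlg]
  | succ l ih =>
    have h₁ := ih (Fin.init y) (Fin.init z)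
    have h₂ : degreeOf v (Polynomial.aeval (z (Fin.last l)) (switchPoly c i)) ≤
        n * degreeOf v (z (Fin.last l)) := (degreeOf_polynomial_aeval_le _ _ _).trans
      (Nat.mul_le_mul_right _ (natDegree_switchPoly_le hc i))
    have h₃ : degreeOf v (1 - Polynomial.aeval (z (Fin.last l)) (switchPoly c i)) ≤
        n * degreeOf v (z (Fin.last l)) :=
      (degreeOf_sub_le _ _ _).trans (max_le (by simp) h₂)
    have h₄ : degreeOf v (aeval (y (Fin.last l)) (L i)) ≤
        n * ∑ b, degreeOf v (y (Fin.last l) b) := by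
      rw [aeval_eq_bind₁]
      refine degreeOf_bind₁_le _ _ _ _ fun e he => ?_
      rw [Finset.mul_sum]
      refine Finset.sum_le_sum fun b _ => Nat.mul_le_mul_right _ ?_
      exact ((monomial_le_degreeOf b he).trans (hL i b)).trans (Nat.sub_le _ _)
    rw [genSAlg, Fin.sum_univ_castSucc, Fin.sum_univ_castSucc]
    simp only [Fin.init] at h₁
    refine (degreeOf_add_le _ _ _).trans (max_le ?_ ?_)
    · refine (degreeOf_mul_le _ _ _).trans ((add_le_add h₁ h₂).trans ?_)
      rw [← mul_add]
      exact Nat.mul_le_mul_left _ (by omega)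
    · refine (degreeOf_mul_le _ _ _).trans ((add_le_add h₄ h₃).trans ?_)
      rw [← mul_add]
      exact Nat.mul_le_mul_left _ (by omega)

/-! ### The hitting set -/

theorem aeval_poly {K : Type*} [Field K] [Algebra F K] {k : ℕ} (C : UnmixedCircuit F n k)
    (x : Fin n → K) : aeval x C.poly =
      ∑ i, ∏ j, ((C.f i j).map (algebraMap F K)).eval (x j) := by
  simp only [UnmixedCircuit.poly, map_sum, map_prod, ← Polynomial.aeval_algHom_apply, aeval_X,
    Polynomial.eval_map_algebraMap]

theorem exists_aeval_ne_zero {K : Type*} [Field K] [Algebra F K] [Infinite K]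
    {P : MvPolynomial σ F} (hP : P ≠ 0) : ∃ x : σ → K, aeval x P ≠ 0 := by
  by_contra! h
  refine hP (map_injective _ (algebraMap F K).injective (MvPolynomial.funext fun x => ?_))
  simpa [aeval_def, eval_map] using h x

/-- The composition of the circuit with the mapping in generic variables is a polynomial over `F`. A
point over the algebraic closure shows that it is nonzero, and its degree in each variable is at
most `n * n < |U|`, so it cannot vanish on the whole grid over `U`. -/
theorem isHittingSet_outputSet {k s : ℕ} {L : Fin n → MvPolynomial (Fin q) F}
    (hL : ∀ i (p : Polynomial (AlgebraicClosure F)), p ≠ 0 →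
      Polynomial.aeval (map (algebraMap F (AlgebraicClosure F)) (L i)) p ≠ 0)
    (hd : ∀ i j, (L i).degreeOf j ≤ n - 1) {c : Fin (n + 1) → F} (hc : Function.Injective c)
    {U : Finset F} (hU : n * n < U.card) :
    IsHittingSet (outputSet L c U k) (lowDegreeUnmixed F n k s) := by
  rintro P ⟨C, -, hdeg, rfl⟩ hP
  have : Infinite (AlgebraicClosure F) := IsAlgClosed.instInfinite
  obtain ⟨x, hx⟩ := exists_aeval_ne_zero (K := AlgebraicClosure F) hP
  rw [aeval_poly] at hx
  obtain ⟨y, z, hyz⟩ := exists_genSAlg_ne_zero hL hc (fun _ => 1)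
    (fun i j => (C.f i j).map (algebraMap F (AlgebraicClosure F))) x (by simpa using hx)
  set Y : Fin k → Fin q → MvPolynomial ((Fin k × Fin q) ⊕ Fin k) F := fun a b => X (.inl (a, b))
  set Z : Fin k → MvPolynomial ((Fin k × Fin q) ⊕ Fin k) F := fun a => X (.inr a)
  have hmap : ∀ {K : Type _} [Field K] [Algebra F K] (u : (Fin k × Fin q) ⊕ Fin k → K),
      aeval u (bind₁ (genSAlg L c k Y Z) C.poly) =
        aeval (genSAlg L c k (fun a b => u (.inl (a, b))) (fun a => u (.inr a))) C.poly := by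
    intro K _ _ u
    rw [aeval_bind₁]
    congr 2
    funext i
    simp [map_genSAlg, Y, Z]
  have hQ : bind₁ (genSAlg L c k Y Z) C.poly ≠ 0 := by
    intro h0
    have := hmap (Sum.elim (fun p => y p.1 p.2) z)
    rw [h0, map_zero, aeval_poly] at this
    exact hyz (by simpa using this.symm)
  have hdegQ : ∀ v, degreeOf v (bind₁ (genSAlg L c k Y Z) C.poly) < U.card := by
    classical
    intro v
    refine lt_of_le_of_lt (degreeOf_bind₁_le _ _ _ (n * n) fun e he => ?_) hU
    have hG : ∀ i, degreeOf v (genSAlg L c k Y Z i) ≤ n := by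
      intro i
      refine (degreeOf_genSAlg_le hd hc k Y Z i v).trans ?_
      rw [← Fintype.sum_prod_type']
      simp only [Y, Z, degreeOf_X]
      rcases v with v | v <;> simp
    calc ∑ j, e j * degreeOf v (genSAlg L c k Y Z j) ≤ ∑ j, e j * n :=
          Finset.sum_le_sum fun j _ => Nat.mul_le_mul_left _ (hG j)
      _ = (∑ j, e j) * n := by rw [Finset.sum_mul]
      _ ≤ n * n := Nat.mul_le_mul_right _ (le_trans ?_ hdeg)
    have := le_totalDegree he
    rwa [Finsupp.sum_fintype _ _ (fun _ => rfl)] at this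
  obtain ⟨u, huU, hu⟩ : ∃ u : (Fin k × Fin q) ⊕ Fin k → F, (∀ v, u v ∈ U) ∧
      eval u (bind₁ (genSAlg L c k Y Z) C.poly) ≠ 0 := by
    by_contra! h
    exact hQ (eq_zero_of_eval_zero_at_prod_finset _ (fun _ => U) hdegQ h)
  refine ⟨_, ⟨fun a b => u (.inl (a, b)), fun a => u (.inr a), fun a b => huU _, fun a => huU _,
    rfl⟩, ?_⟩
  have := hmap u
  rw [aeval_eq_eval, aeval_eq_eval] at this
  rw [genS_eq_genSAlg]
  simpa [this] using hu

end

/-! ### Interpolation polynomials -/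

section

open MvPolynomial

variable {F : Type*} [Field F] {n q : ℕ}

/-- Links the two readings of the construction: the list of interpolation polynomials, with
variables as arguments, evaluates to the list of field elements that the program computes. -/
theorem map_lagrangeTensor {R S : Type*} [CommRing R] [Algebra F R] [CommRing S] [Algebra F S]
    (φ : R →ₐ[F] S) (W : List F) (q : ℕ) (y : Fin q → R) :
    (lagrangeTensor W q y).map φ = lagrangeTensor W q fun j => φ (y j) := by
  have hval : ∀ w (x : R), φ (lagrangeVal W w x) = lagrangeVal W w (φ x) := by
    classical
    intro w x
    simp only [lagrangeVal, map_list_prod, List.map_map]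
    congr 2
    funext a
    simp only [Function.comp_apply, apply_ite φ, map_one, map_mul, map_sub, AlgHom.commutes]
  have hrow : ∀ x : R, (lagrangeRow W x).map φ = lagrangeRow W (φ x) := by
    intro x
    simp [lagrangeRow, Function.comp_def, hval]
  have htensor : ∀ u v : List R, (tensor u v).map φ = tensor (u.map φ) (v.map φ) := by
    intro u v
    simp [tensor, List.map_flatMap, List.flatMap_map, Function.comp_def]
  induction q with
  | zero => simp [lagrangeTensor]
  | succ q ih =>
    rw [lagrangeTensor, htensor, hrow, ih]
    rfl

theorem map_dot {R S : Type*} [CommRing R] [Algebra F R] [CommRing S] [Algebra F S]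
    (φ : R →ₐ[F] S) (u : List R) (h : List (Fin n → F)) (i : Fin n) :
    φ (dot u h i) = dot (u.map φ) h i := by
  simp only [dot, map_sum, map_mul, AlgHom.commutes]
  refine Finset.sum_congr rfl fun j _ => ?_
  congr 1
  rw [List.getD_eq_getElem?_getD, List.getD_eq_getElem?_getD, List.getElem?_map]
  cases u[j]? <;> simp

theorem lagrangeVal_self (W : List F) (x : F) : lagrangeVal W x x = 1 := by
  classical
  refine List.prod_eq_one fun a ha => ?_
  obtain ⟨b, -, rfl⟩ := List.mem_map.1 ha
  split_ifs with h
  · rfl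
  · exact mul_inv_cancel₀ (sub_ne_zero.2 h)

theorem lagrangeVal_of_ne {W : List F} {w x : F} (hx : x ∈ W) (hw : w ≠ x) :
    lagrangeVal W w x = 0 := by
  classical
  refine List.prod_eq_zero (List.mem_map.2 ⟨x, hx, ?_⟩)
  rw [if_neg hw]
  simp

theorem lagrangeRow_getElem {W : List F} (hW : W.Nodup) {i : ℕ} (hi : i < W.length) :
    lagrangeRow W W[i] = List.replicate (W.length - 1 - i) 0 ++ 1 :: List.replicate i 0 := by
  refine List.ext_getElem (by simp; omega) fun j h₁ h₂ => ?_
  simp only [length_lagrangeRow] at h₁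
  simp only [lagrangeRow, List.getElem_reverse, List.getElem_map, List.length_map]
  rcases lt_trichotomy j (W.length - 1 - i) with h | h | h
  · rw [List.getElem_append_left (by simpa using h), List.getElem_replicate]
    refine lagrangeVal_of_ne (List.getElem_mem hi) fun h' => ?_
    have := (hW.getElem_inj_iff).1 h'
    omega
  · have : W.length - 1 - j = i := by omega
    simp only [this, lagrangeVal_self]
    simp [h]
  · rw [List.getElem_append_right (by simpa using h.le), List.getElem_cons,
      dif_neg (by simp; omega), List.getElem_replicate]
    refine lagrangeVal_of_ne (List.getElem_mem hi) fun h' => ?_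
    have := (hW.getElem_inj_iff).1 h'
    omega

theorem flatMap_replicate_zero (a : ℕ) (v : List F) :
    ((List.replicate a (0 : F)).flatMap fun b => v.map (b * ·)) =
      List.replicate (a * v.length) 0 := by
  induction a with
  | zero => simp
  | succ a ih =>
    rw [List.replicate_succ, List.flatMap_cons, ih, Nat.succ_mul, Nat.add_comm,
      List.replicate_add]
    simp [List.map_const']

/-- On the grid `W^q`, the interpolation polynomials take the values of the unit vectors. -/
theorem exists_lagrangeTensor_eq {W : List F} (hW : W.Nodup) (q : ℕ) {j : ℕ}
    (hj : j < W.length ^ q) : ∃ y : Fin q → F, lagrangeTensor W q y =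
      List.replicate j 0 ++ 1 :: List.replicate (W.length ^ q - 1 - j) 0 := by
  induction q generalizing j with
  | zero =>
    obtain rfl : j = 0 := by simpa using hj
    exact ⟨0, rfl⟩
  | succ q ih =>
    set N := W.length ^ q with hN
    have hN0 : 0 < N := by
      rcases Nat.eq_zero_or_pos W.length with h | h
      · rw [h] at hj
        simp at hj
      · exact Nat.pow_pos h
    rw [pow_succ, ← hN] at hj ⊢
    have hb : j / N < W.length := Nat.div_lt_of_lt_mul hj
    have hr := Nat.mod_lt j hN0
    have hdm := Nat.div_add_mod' j N
    -- The index `j` is split into the digits `j / N` and `j % N`. The reversals in `lagrangeRow`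
    -- and `tensor` cancel for the leading digit, while the inner list is reversed once, whence the
    -- complementary index.
    obtain ⟨y, hy⟩ := ih (j := N - 1 - j % N) (by omega)
    refine ⟨Fin.snoc (α := fun _ => F) y W[j / N], ?_⟩
    have hlen : (lagrangeTensor W q y).length = N := length_lagrangeTensor W q y
    rw [lagrangeTensor, Fin.snoc_last, Fin.init_snoc, lagrangeRow_getElem hW hb, tensor,
      List.flatMap_append, List.flatMap_cons, flatMap_replicate_zero, flatMap_replicate_zero, hlen]
    simp only [one_mul, List.map_id', hy]
    have e₁ : N - 1 - (N - 1 - j % N) = j % N := by omega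
    simp only [List.reverse_append, List.reverse_replicate, List.reverse_cons, e₁]
    have e₂ : List.replicate j (0 : F) = List.replicate (j / N * N) 0 ++ List.replicate (j % N) 0 := by
      rw [← List.replicate_add, hdm]
    have e₃ : List.replicate (N * W.length - 1 - j) (0 : F) =
        List.replicate (N - 1 - j % N) 0 ++ List.replicate ((W.length - 1 - j / N) * N) 0 := by
      rw [← List.replicate_add]
      congr 1
      have : (W.length - 1 - j / N) * N + (j / N * N + N) = N * W.length := by
        rw [← Nat.succ_mul, ← Nat.add_mul, mul_comm]
        congr 1
        omega
      omega
    rw [e₂, e₃]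
    simp only [List.append_assoc, List.cons_append, List.nil_append]

/-- The polynomial mapping that interpolates the list `h` of points on the grid `W^q`. -/
def gridGenerator (W : List F) (q : ℕ) (h : List (Fin n → F)) (i : Fin n) :
    MvPolynomial (Fin q) F :=
  dot (lagrangeTensor W q X) h i

theorem eval_gridGenerator (W : List F) (h : List (Fin n → F)) (y : Fin q → F) (i : Fin n) :
    eval y (gridGenerator W q h i) = dot (lagrangeTensor W q y) h i := by
  rw [← aeval_eq_eval, gridGenerator, map_dot, map_lagrangeTensor]
  simp

/-- The grid point whose interpolation values form the `j`-th unit vector is mapped to the `j`-th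
point of the list. The list may be shorter than the grid. -/
theorem exists_eval_gridGenerator {W : List F} (hW : W.Nodup) {h : List (Fin n → F)}
    (hh : h.length ≤ W.length ^ q) {a : Fin n → F} (ha : a ∈ h) :
    ∃ y, (fun i => eval y (gridGenerator W q h i)) = a := by
  obtain ⟨j, hj, rfl⟩ := List.getElem_of_mem ha
  obtain ⟨y, hy⟩ := exists_lagrangeTensor_eq hW q (hj.trans_le hh)
  refine ⟨y, funext fun i => ?_⟩
  rw [eval_gridGenerator, hy, dot, Finset.sum_eq_single j]
  · simp [List.getD_eq_getElem?_getD, hj]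
  · intro l _ hl
    have : (List.replicate j (0 : F) ++ 1 :: List.replicate (W.length ^ q - 1 - j) 0).getD l 0 =
        0 := by
      rw [List.getD_eq_getElem?_getD, List.getElem?_append, List.length_replicate]
      split_ifs with h
      · simp [h]
      · obtain ⟨t, ht⟩ : ∃ t, l - j = t + 1 := ⟨l - j - 1, by omega⟩
        rw [ht, List.getElem?_cons_succ, List.getElem?_replicate]
        split_ifs <;> rfl
    rw [this, zero_mul]
  · intro hj'
    exact absurd (Finset.mem_range.2 hj) hj'

theorem degreeOf_list_prod_le {σ : Type*} (v : σ) (l : List (MvPolynomial σ F)) (d : ℕ)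
    (hl : ∀ p ∈ l, degreeOf v p ≤ d) : degreeOf v l.prod ≤ l.length * d := by
  induction l with
  | nil => simp
  | cons p l ih =>
    rw [List.prod_cons, List.length_cons, Nat.succ_mul, Nat.add_comm]
    refine (degreeOf_mul_le _ _ _).trans (add_le_add (hl p (by simp)) (ih fun p hp => ?_))
    exact hl p (by simp [hp])

/-- The entry `w` contributes the factor `1`. This saves the one degree that separates `n - 1` from
`n` in the bound for the generator. -/
theorem degreeOf_lagrangeVal_le {σ : Type*} (v : σ) {W : List F} {w : F} (hw : w ∈ W)
    (y : MvPolynomial σ F) : degreeOf v (lagrangeVal W w y) ≤ (W.length - 1) * degreeOf v y := by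
  classical
  obtain ⟨W₁, W₂, rfl⟩ := List.append_of_mem hw
  set g : F → MvPolynomial σ F := fun x =>
    if w = x then 1 else (y - algebraMap F _ x) * algebraMap F _ (w - x)⁻¹ with hg
  have hval : lagrangeVal (W₁ ++ w :: W₂) w y = (W₁.map g).prod * (W₂.map g).prod := by
    rw [lagrangeVal, List.map_append, List.map_cons, List.prod_append, List.prod_cons, if_pos rfl,
      one_mul]
  have hdeg : ∀ l : List F, degreeOf v (l.map g).prod ≤ l.length * degreeOf v y := by
    intro l
    have := degreeOf_list_prod_le v (l.map g) (degreeOf v y) fun p hp => ?_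
    · simpa using this
    · obtain ⟨x, -, rfl⟩ := List.mem_map.1 hp
      simp only [hg]
      split_ifs
      · simp
      · refine (degreeOf_mul_C_le _ _ _).trans ((degreeOf_sub_le _ _ _).trans ?_)
        rw [algebraMap_eq, degreeOf_C]
        simp
  rw [hval]
  refine (degreeOf_mul_le _ _ _).trans ((add_le_add (hdeg W₁) (hdeg W₂)).trans ?_)
  rw [← add_mul]
  exact Nat.mul_le_mul_right _ (by simp)

theorem degreeOf_le_of_mem_lagrangeTensor {σ : Type*} (v : σ) (W : List F) (q : ℕ)
    (y : Fin q → MvPolynomial σ F) {u : MvPolynomial σ F} (hu : u ∈ lagrangeTensor W q y) :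
    degreeOf v u ≤ (W.length - 1) * ∑ j, degreeOf v (y j) := by
  induction q generalizing u with
  | zero =>
    obtain rfl : u = 1 := by simpa [lagrangeTensor] using hu
    simp
  | succ q ih =>
    simp only [lagrangeTensor, tensor, lagrangeRow, List.mem_reverse, List.mem_flatMap,
      List.mem_map] at hu
    obtain ⟨_, ⟨w, hw, rfl⟩, u', hu', rfl⟩ := hu
    have := ih (Fin.init y) hu'
    rw [Fin.sum_univ_castSucc, mul_add, add_comm]
    exact (degreeOf_mul_le _ _ _).trans (add_le_add (degreeOf_lagrangeVal_le v hw _) this)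

theorem degreeOf_gridGenerator_le (W : List F) (h : List (Fin n → F)) (i : Fin n) (j : Fin q) :
    degreeOf j (gridGenerator W q h i) ≤ W.length - 1 := by
  classical
  refine (degreeOf_sum_le _ _ _).trans (Finset.sup_le fun l _ => ?_)
  refine (degreeOf_mul_C_le _ _ _).trans ?_
  by_cases hl : l < (lagrangeTensor W q (X : Fin q → MvPolynomial (Fin q) F)).length
  · rw [List.getD_eq_getElem _ _ hl]
    refine (degreeOf_le_of_mem_lagrangeTensor j W q X (List.getElem_mem hl)).trans ?_
    simp [degreeOf_X]
  · rw [List.getD_eq_default _ _ (by omega)]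
    simp

end

/-! ### A modulus that separates exponent vectors -/

/-- Every prime power that divides the central binomial coefficient of `r` is at most `2 * r`. If
all `p ≤ 2 * r` divided `D`, the coefficient would divide `D` and be less than `2 ^ r`,
contradicting `4 ^ r < r * r.centralBinom`. No estimate for the number of primes is needed. -/
theorem exists_not_dvd_of_lt_two_pow {D r : ℕ} (hr : 4 ≤ r) (hD₀ : D ≠ 0) (hD : D < 2 ^ r) :
    ∃ p, 1 ≤ p ∧ p ≤ 2 * r ∧ ¬ p ∣ D := by
  by_contra! h
  have hdvd : r.centralBinom ∣ D := by
    rw [Nat.dvd_iff_prime_pow_dvd_dvd]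
    intro p k hp hk
    refine h _ (Nat.one_le_pow _ _ hp.pos) ?_
    refine le_trans (Nat.pow_le_pow_right hp.pos ?_)
      (Nat.pow_factorization_choose_le (p := p) (n := 2 * r) (k := r) (by omega))
    exact (hp.pow_dvd_iff_le_factorization r.centralBinom_ne_zero).1 hk
  have h₁ := Nat.le_of_dvd (Nat.pos_of_ne_zero hD₀) hdvd
  have h₂ := Nat.four_pow_lt_mul_centralBinom r hr
  have h₃ : r * r.centralBinom ≤ 2 ^ r * 2 ^ r :=
    Nat.mul_le_mul Nat.lt_two_pow_self.le (h₁.trans hD.le)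
  rw [← mul_pow] at h₃
  norm_num at h₃
  omega

theorem abs_sum_mul_pow_lt {N : ℕ} {b : ℤ} (hb : |b| = N + 1) (l : ℕ) (d : Fin l → ℤ)
    (hd : ∀ i, |d i| ≤ N) : |∑ i, d i * b ^ (i : ℕ)| < (N + 1) ^ l := by
  induction l with
  | zero => simp
  | succ l ih =>
    rw [Fin.sum_univ_castSucc]
    have h₁ := ih (fun i => d i.castSucc) fun i => hd _
    have h₂ : |d (Fin.last l) * b ^ l| ≤ N * (N + 1) ^ l := by
      rw [abs_mul, abs_pow, hb]
      exact mul_le_mul_of_nonneg_right (hd _) (by positivity)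
    refine (abs_add_le _ _).trans_lt ?_
    simp only [Fin.val_castSucc, Fin.val_last]
    calc _ < ((N : ℤ) + 1) ^ l + N * (N + 1) ^ l := add_lt_add_of_lt_of_le h₁ h₂
      _ = _ := by ring

/-- Uniqueness of digits: the lowest digit is divisible by `b` and smaller than `b` in absolute
value, hence zero; then divide by `b`. -/
theorem eq_zero_of_sum_mul_pow_eq_zero {N : ℕ} {b : ℤ} (hb : |b| = N + 1) (l : ℕ) (d : Fin l → ℤ)
    (hd : ∀ i, |d i| ≤ N) (h : ∑ i, d i * b ^ (i : ℕ) = 0) : d = 0 := by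
  induction l with
  | zero => exact Subsingleton.elim _ _
  | succ l ih =>
    have hb₀ : b ≠ 0 := by
      rintro rfl
      simp at hb
      omega
    have hsum : ∑ i : Fin l, d i.succ * b ^ ((i : ℕ) + 1) =
        b * ∑ i : Fin l, d i.succ * b ^ (i : ℕ) := by
      rw [Finset.mul_sum]
      exact Finset.sum_congr rfl fun i _ => by ring
    rw [Fin.sum_univ_succ] at h
    simp only [Fin.val_zero, pow_zero, mul_one, Fin.val_succ, hsum] at h
    have h₀ : d 0 = 0 := by
      refine Int.eq_zero_of_abs_lt_dvd (m := |b|) ((abs_dvd _ _).2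
        ⟨-∑ i : Fin l, d i.succ * b ^ (i : ℕ), by linear_combination h⟩) ?_
      rw [hb]
      exact Int.lt_add_one_of_le (hd 0)
    rw [h₀, zero_add] at h
    have := ih (fun i => d i.succ) (fun i => hd _) ((mul_eq_zero.1 h).resolve_left hb₀)
    funext i
    induction i using Fin.cases with
    | zero => exact h₀
    | succ i => exact congrFun this i

theorem decMod_modEq {p r : ℕ} (hr : 1 ≤ r) : (decMod p r : ℤ) ≡ r - 1 [ZMOD p] := by
  unfold decMod
  split_ifs with h
  · obtain rfl : r = 1 := by omega
    simp [Int.ModEq]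
  · rw [Nat.cast_sub hr]
    rfl

/-- Counting down `(n + 1) * w` times from `p` yields the residue of `-(n + 1) * w`. The negative
base makes the recursion computable by predecessors alone. -/
theorem weight_modEq {n p : ℕ} (hp : 1 ≤ p) (i : ℕ) :
    (weight n p i : ℤ) ≡ (-(n + 1)) ^ i [ZMOD p] := by
  have hpos : ∀ j, 1 ≤ (decMod p)^[j] p := by
    intro j
    cases j with
    | zero => exact hp
    | succ j =>
      rw [Function.iterate_succ_apply']
      exact decMod_pos hp _
  have hit : ∀ j : ℕ, ((decMod p)^[j] p : ℤ) ≡ -j [ZMOD p] := by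
    intro j
    induction j with
    | zero => simp [Int.ModEq]
    | succ j ih =>
      rw [Function.iterate_succ_apply']
      refine (decMod_modEq (hpos j)).trans ?_
      have := ih.sub_right 1
      rwa [show (-((j + 1 : ℕ) : ℤ)) = -(j : ℤ) - 1 by push_cast; ring]
  induction i with
  | zero => simp [weight]
  | succ i ih =>
    rw [weight]
    refine (hit _).trans ?_
    have := ih.mul_left (-((n : ℤ) + 1))
    rw [pow_succ']
    push_cast
    rwa [← neg_mul]

/-- Exponent vectors of degree at most `n` are separated from a given one by the weights for some
small modulus. -/
theorem exists_weight_separates {n m : ℕ} (hn : 2 ≤ n) (hm : 1 ≤ m) (e : Fin n →₀ ℕ)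
    (s : Finset (Fin n →₀ ℕ)) (hs : s.card < m) (hes : e ∉ s) (he : ∀ i, e i ≤ n)
    (hsn : ∀ e' ∈ s, ∀ i, e' i ≤ n) :
    ∃ p, 1 ≤ p ∧ p ≤ 2 * (n * n * m) ∧
      ∀ e' ∈ s, ∑ i, e i * weight n p i ≠ ∑ i, e' i * weight n p i := by
  have hb : |-((n : ℤ) + 1)| = n + 1 := by
    rw [abs_neg, abs_of_nonneg (by positivity)]
  set Δ : (Fin n →₀ ℕ) → ℤ := fun e' => ∑ i, ((e i : ℤ) - e' i) * (-((n : ℤ) + 1)) ^ (i : ℕ) with hΔ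
  have hd : ∀ e' ∈ s, ∀ i, |(e i : ℤ) - e' i| ≤ n := by
    intro e' he' i
    have h₁ := he i
    have h₂ := hsn e' he' i
    rw [abs_le]
    omega
  -- The digit bound gives `(n + 1) ^ n`, and `n + 1 ≤ 2 ^ n`.
  have hlt : ∀ e' ∈ s, (Δ e').natAbs ≤ 2 ^ (n * n) := by
    intro e' he'
    have h₁ := abs_sum_mul_pow_lt hb n _ (hd e' he')
    have h₂ : (n + 1) ^ n ≤ 2 ^ (n * n) := by
      rw [pow_mul]
      exact Nat.pow_le_pow_left (Nat.lt_two_pow_self (n := n)) n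
    refine le_trans (le_of_lt ?_) h₂
    zify
    exact h₁
  have hr : 2 * 2 * 1 ≤ n * n * m := Nat.mul_le_mul (Nat.mul_le_mul hn hn) hm
  have hD₀ : ∏ e' ∈ s, (Δ e').natAbs ≠ 0 := by
    refine Finset.prod_ne_zero_iff.2 fun e' he' h0 => hes ?_
    have := eq_zero_of_sum_mul_pow_eq_zero hb n _ (hd e' he') (Int.natAbs_eq_zero.1 h0)
    have : e = e' := by
      ext i
      have := congrFun this i
      simp only [Pi.zero_apply] at this
      omega
    rwa [this]
  have hD : ∏ e' ∈ s, (Δ e').natAbs < 2 ^ (n * n * m) :=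
    calc ∏ e' ∈ s, (Δ e').natAbs ≤ (2 ^ (n * n)) ^ s.card := Finset.prod_le_pow_card _ _ _ hlt
      _ < (2 ^ (n * n)) ^ m := Nat.pow_lt_pow_right (Nat.one_lt_two_pow (by positivity)) hs
      _ = _ := (pow_mul _ _ _).symm
  obtain ⟨p, hp, hpr, hpD⟩ := exists_not_dvd_of_lt_two_pow hr hD₀ hD
  refine ⟨p, hp, hpr, fun e' he' heq => hpD (dvd_trans ?_ (Finset.dvd_prod_of_mem _ he'))⟩
  rw [← Int.natCast_dvd]
  refine (Int.modEq_zero_iff_dvd).1 ?_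
  -- Modulo `p` the weights are the powers of `-(n + 1)`, so equal weighted sums would make `p`
  -- divide the factor `Δ e'` of the product.
  have : ∑ i, ((e i : ℤ) - e' i) * (weight n p i : ℤ) = 0 := by
    simp only [sub_mul, Finset.sum_sub_distrib, sub_eq_zero]
    exact_mod_cast heq
  rw [← this]
  refine Int.ModEq.symm (Int.ModEq.sum fun i _ => ?_)
  exact (weight_modEq hp i).mul_left _

/-! ### The generator for sparse polynomials -/

section

open MvPolynomial

variable {F : Type*} [Field F] {n : ℕ}

/-- For a separating modulus no other monomial falls on the power of `y` that belongs to `e`, so its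
coefficient survives the substitution. The resulting nonzero univariate polynomial has fewer zeros
than `Y` has entries. -/
theorem exists_weightPoint_ne_zero {m : ℕ} (hn : 2 ≤ n) (hm : 1 ≤ m) {P : MvPolynomial (Fin n) F}
    (hP : P ∈ sparseLowDegree F n m) (hP₀ : P ≠ 0) {Y : List F} (hY : Y.Nodup)
    (hYl : n * (2 * (n * n * m)) < Y.length) :
    ∃ p, 1 ≤ p ∧ p ≤ 2 * (n * n * m) ∧ ∃ y ∈ Y, eval (weightPoint n p y) P ≠ 0 := by
  classical
  obtain ⟨e, he⟩ := support_nonempty.2 hP₀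
  have hle : ∀ e' ∈ P.support, ∑ i, e' i ≤ n := by
    intro e' he'
    have := le_totalDegree he'
    rw [Finsupp.sum_fintype _ _ (fun _ => rfl)] at this
    exact this.trans hP.2
  have hlei : ∀ e' ∈ P.support, ∀ i, e' i ≤ n := fun e' he' i =>
    (Finset.single_le_sum (f := fun i => e' i) (fun _ _ => Nat.zero_le _)
      (Finset.mem_univ i)).trans (hle e' he')
  obtain ⟨p, hp, hpX, hsep⟩ := exists_weight_separates hn hm e (P.support.erase e)
    (by
      have := Finset.card_erase_lt_of_mem he
      have := hP.1
      omega)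
    (Finset.notMem_erase _ _) (hlei e he) fun e' he' => hlei e' (Finset.mem_of_mem_erase he')
  refine ⟨p, hp, hpX, ?_⟩
  by_contra! hzero
  set Q : Polynomial F := aeval (fun i : Fin n => (Polynomial.X : Polynomial F) ^ weight n p i) P
    with hQ
  have hQe : Q = ∑ e' ∈ P.support,
      Polynomial.C (coeff e' P) * Polynomial.X ^ (∑ i, e' i * weight n p i) := by
    rw [hQ, aeval_def, eval₂_eq']
    refine Finset.sum_congr rfl fun e' _ => ?_
    rw [← Finset.prod_pow_eq_pow_sum]
    congr 1
    exact Finset.prod_congr rfl fun i _ => by rw [← pow_mul, mul_comm]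
  have hdeg : Q.natDegree ≤ n * (2 * (n * n * m)) := by
    rw [hQe]
    refine Polynomial.natDegree_sum_le_of_forall_le _ _ fun e' he' => ?_
    refine (Polynomial.natDegree_C_mul_X_pow_le _ _).trans ?_
    calc ∑ i, e' i * weight n p i ≤ ∑ i, e' i * (2 * (n * n * m)) :=
          Finset.sum_le_sum fun i _ => Nat.mul_le_mul_left _ ((weight_le hp n i).trans hpX)
      _ = (∑ i, e' i) * (2 * (n * n * m)) := by rw [Finset.sum_mul]
      _ ≤ _ := Nat.mul_le_mul_right _ (hle e' he')
  have hQ0 : Q = 0 := by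
    refine Polynomial.eq_zero_of_natDegree_lt_card_of_eval_eq_zero' Q Y.toFinset (fun y hy => ?_) ?_
    · have := hzero y (List.mem_toFinset.1 hy)
      rw [← Polynomial.coe_aeval_eq_eval, hQ, comp_aeval_apply]
      simpa [weightPoint, aeval_eq_eval, Function.comp_def] using (show eval
        (fun i : Fin n => y ^ weight n p i) P = 0 from this)
    · rw [List.toFinset_card_of_nodup hY]
      omega
  have hcoeff : Q.coeff (∑ i, e i * weight n p i) = coeff e P := by
    rw [hQe, Polynomial.finsetSum_coeff, Finset.sum_eq_single e]
    · simp
    · intro e' he' hne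
      rw [Polynomial.coeff_C_mul_X_pow, if_neg (hsep e' (Finset.mem_erase.2 ⟨hne, he'⟩))]
    · exact fun h => absurd he h
  rw [hQ0, Polynomial.coeff_zero] at hcoeff
  exact mem_support_iff.1 he hcoeff.symm

/-- The generator for the polynomials with at most `m` monomials. -/
def sparseGenerator (n m : ℕ) (us : List F) : Fin n → MvPolynomial (Fin (numVars n m)) F :=
  gridGenerator (us.take n).reverse (numVars n m) (sparseHitting n m us)

/-- A polynomial mapping whose image contains a hitting set is a generator: the composition is
nonzero at a preimage of the point that hits. -/
theorem isGenerator_sparseGenerator {m : ℕ} (hn : 2 ≤ n) (hm : 1 ≤ m) {us : List F}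
    (hus : us.Nodup) (hlen : n * n * n * (n * n * m) ≤ us.length) :
    IsGenerator (sparseGenerator n m us) (sparseLowDegree F n m) := by
  intro P hP hP₀
  have hX : 2 * 2 * 1 ≤ n * n * m := Nat.mul_le_mul (Nat.mul_le_mul hn hn) hm
  have hnn : 2 * 2 ≤ n * n := Nat.mul_le_mul hn hn
  obtain ⟨p, hp, hpX, y, hy, hne⟩ := exists_weightPoint_ne_zero hn hm hP hP₀
    (Y := (us.take (n * n * n * (n * n * m))).reverse)
    (List.nodup_reverse.2 (hus.sublist (List.take_sublist _ _))) (by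
      rw [List.length_reverse, List.length_take, min_eq_left hlen]
      nlinarith [Nat.mul_le_mul_right (n * (n * n * m)) hnn])
  have hlW : (us.take n).reverse.length = n := by
    rw [List.length_reverse, List.length_take]
    have hn3 : n ≤ n * n * n := by nlinarith
    exact min_eq_left ((hn3.trans (Nat.le_mul_of_pos_right _ (by omega))).trans hlen)
  obtain ⟨w, hw⟩ := exists_eval_gridGenerator (W := (us.take n).reverse) (q := numVars n m)
    (h := sparseHitting n m us) (List.nodup_reverse.2 (hus.sublist (List.take_sublist _ _)))
    (by rw [hlW]; exact length_sparseHitting_le hn hm us)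
    (weightPoint_mem_pointTable hp (by omega) hy)
  intro h0
  refine hne ?_
  rw [← hw, ← aeval_eq_eval]
  have := congrArg (aeval w) h0
  rw [aeval_bind₁, map_zero] at this
  simpa [sparseGenerator, aeval_eq_eval] using this

theorem degreeOf_sparseGenerator_le (m : ℕ) (us : List F) (i : Fin n)
    (j : Fin (numVars n m)) : (sparseGenerator n m us i).degreeOf j ≤ n - 1 := by
  refine (degreeOf_gridGenerator_le _ _ i j).trans (Nat.sub_le_sub_right ?_ 1)
  rw [List.length_reverse]
  exact List.length_take_le _ _

/-- The components of a generator for sparse polynomials are transcendental. -/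
theorem aeval_map_generator_ne_zero {m q : ℕ} (hm : 2 ≤ m) {L : Fin n → MvPolynomial (Fin q) F}
    (hL : IsGenerator L (sparseLowDegree F n m)) (i : Fin n)
    {p : Polynomial (AlgebraicClosure F)} (hp : p ≠ 0) :
    Polynomial.aeval (map (algebraMap F (AlgebraicClosure F)) (L i)) p ≠ 0 := by
  classical
  have hn : 1 ≤ n := i.pos
  have hconst : ∀ r, map (algebraMap F (AlgebraicClosure F)) (L i) ≠ C r := by
    intro r hr
    have hC : L i = C (coeff 0 (L i)) := by
      refine map_injective _ (algebraMap F (AlgebraicClosure F)).injective ?_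
      rw [hr, map_C, ← coeff_map, hr, coeff_zero_C]
    -- If `L i` were constant, its value would lie in `F`, and this nonzero polynomial with at most
    -- two monomials and degree `1` would vanish on the image of `L`.
    refine hL (X i - C (coeff 0 (L i))) ⟨?_, ?_⟩ ?_ ?_
    · refine ((Finset.card_le_card (support_sub _ _ _)).trans (Finset.card_union_le _ _)).trans
        (le_trans (add_le_add (b := 1) (d := 1) ?_ ?_) hm)
      · rw [support_X, Finset.card_singleton]
      · rw [C_apply]
        exact (Finset.card_le_card support_monomial_subset).trans (by simp)
    · refine (totalDegree_sub _ _).trans (max_le ?_ (by simp))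
      rw [totalDegree_X]
      exact hn
    · intro h0
      have := congrArg (coeff (Finsupp.single i 1)) h0
      rw [coeff_sub, coeff_X, coeff_C, if_neg (Finsupp.single_ne_zero.2 one_ne_zero).symm] at this
      simp at this
    · rw [map_sub, bind₁_X_right, bind₁_C_right, ← hC, sub_self]
  intro h0
  -- Over the closure `p` is a product of linear factors, and none of the differences of `L i` and a
  -- root is zero.
  have hsplit := IsAlgClosed.splits p
  rw [hsplit.eq_prod_roots, map_mul, Polynomial.aeval_C, map_multiset_prod, mul_eq_zero] at h0
  rcases h0 with h0 | h0
  · exact hp (by simpa using h0)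
  · rw [Multiset.prod_eq_zero_iff, Multiset.map_map, Multiset.mem_map] at h0
    obtain ⟨r, -, hr⟩ := h0
    refine hconst r (sub_eq_zero.1 ?_)
    simpa using hr

end

/-! ### The output of the algorithm -/

theorem toElts_ofElts {F : Type*} (l : List F) : (Value.ofElts l).toElts = l := by
  induction l with
  | nil => rfl
  | cons a l ih =>
    have : Value.ofElts (a :: l) = .cons (.elt a) (.ofElts l) := rfl
    rw [this, Value.toElts, ih]

section

open MvPolynomial

variable {F : Type*} [Field F] {n : ℕ}

theorem mem_sweep {q : ℕ} {L : Fin n → MvPolynomial (Fin q) F} {c : Fin (n + 1) → F}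
    {U : Finset F} {LV WV : List (Fin n → F)}
    (hL : ∀ a, a ∈ LV ↔ ∃ y : Fin q → F, (∀ j, y j ∈ U) ∧ (fun i => eval y (L i)) = a)
    (hW : ∀ w, w ∈ WV ↔ ∃ z ∈ U, switchPoint c z = w) (k : ℕ) :
    {a | a ∈ sweep LV WV k} = outputSet L c U k := by
  ext a
  induction k generalizing a with
  | zero =>
    simp only [sweep, outputSet, genS, Set.mem_ofPred_eq, List.mem_singleton, IsEmpty.forall_iff,
      true_and, exists_const]
    exact eq_comm
  | succ k ih =>
    simp only [Set.mem_ofPred_eq, outputSet] at ih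
    simp only [sweep, Set.mem_ofPred_eq, List.mem_reverse, List.mem_flatMap, List.mem_map, ih, hL,
      hW, outputSet]
    constructor
    · rintro ⟨_, ⟨y, z, hy, hz, rfl⟩, _, ⟨y₀, hy₀, rfl⟩, _, ⟨z₀, hz₀, rfl⟩, rfl⟩
      refine ⟨Fin.snoc (α := fun _ => Fin q → F) y y₀, Fin.snoc (α := fun _ => F) z z₀, ?_, ?_, ?_⟩
      · intro i j
        induction i using Fin.lastCases <;> simp [hy₀, hy]
      · intro i
        induction i using Fin.lastCases <;> simp [hz₀, hz]
      · funext i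
        simp [genS, switchTo, switchPoint]
    · rintro ⟨y, z, hy, hz, rfl⟩
      exact ⟨_, ⟨Fin.init y, Fin.init z, fun i j => hy _ j, fun i => hz _, rfl⟩, _,
        ⟨y (Fin.last k), hy _, rfl⟩, _, ⟨z (Fin.last k), hz _, rfl⟩, rfl⟩

theorem mem_outputList [DecidableEq F] (n k m : ℕ) (us : List F) (c : Fin (n + 1) → F) :
    {a | a ∈ outputList n k m us c} =
      outputSet (sparseGenerator n m us) c (sampleList n us).toFinset k := by
  refine mem_sweep (fun a => ?_) (fun w => ?_) k
  · simp only [generatorValues, List.mem_reverse, List.mem_map, mem_lagrangeTable,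
      List.mem_toFinset, sparseGenerator, eval_gridGenerator]
    constructor
    · rintro ⟨_, ⟨y, hy, rfl⟩, rfl⟩
      exact ⟨y, hy, rfl⟩
    · rintro ⟨y, hy, rfl⟩
      exact ⟨_, ⟨y, hy, rfl⟩, rfl⟩
  · simp [switchValues]

theorem blackBox_ofPoint (P : MvPolynomial (Fin n) F) (a : Fin n → F) :
    blackBox P (.ofPoint a) = eval a P := by
  unfold blackBox Value.ofPoint
  congr 1
  congr 1
  funext i
  rw [toElts_ofElts, List.getD_eq_getElem _ _ (by simp), List.getElem_ofFn]

/-- The accumulated value is the numeral `1`, read as true, until a query returns a nonzero value;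
from then on it is `nil`, read as false. -/
theorem runsIn_testP {P : MvPolynomial (Fin n) F} {B : ℕ} {x : Value F} {pts : List (Fin n → F)}
    (h : RunsIn (blackBox P) B algP x (.ofList (pts.map .ofPoint))) (hB : pts.length ≤ B) :
    ∃ v, RunsIn (blackBox P) B testP x v ∧ (v ≠ .nil ↔ ∀ a ∈ pts, eval a P = 0) := by
  classical
  refine ⟨_, RunsIn.foldl (encβ := Value.ofNat F)
    (g := fun b a => if eval a P = 0 then b else 0) h hB (.num 1 _) fun a _ b => ?_, ?_⟩
  · refine .ifZero (.query (.var 0 _)) (fun h => ?_) (fun h => ?_)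
    · have h' : eval a P = 0 := (blackBox_ofPoint P a).symm.trans h
      rw [if_pos h']
      exact .var 1 _
    · have h' : ¬ eval a P = 0 := fun h' => h ((blackBox_ofPoint P a).trans h')
      rw [if_neg h']
      exact .nil
  · have key : ∀ (l : List (Fin n → F)) (b : ℕ),
        l.foldl (fun b a => if eval a P = 0 then b else 0) b ≠ 0 ↔
          b ≠ 0 ∧ ∀ a ∈ l, eval a P = 0 := by
      intro l
      induction l with
      | nil => simp
      | cons a l ih =>
        intro b
        rw [List.foldl_cons, ih]
        by_cases ha : eval a P = 0 <;> simp [ha]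
    rw [Ne, Value.ofNat_eq_nil_iff]
    exact (key pts 1).trans (by simp)

end

/-! ### Numerical bounds -/

theorem numVars_le {n m : ℕ} (hn : 2 ≤ n) (hm : 1 ≤ m) :
    (numVars n m : ℝ) ≤ 10 * (1 + Real.logb n m) := by
  have hn' : (1 : ℝ) < n := by exact_mod_cast hn
  have hm' : (1 : ℝ) ≤ m := by exact_mod_cast hm
  have hcl : (clogAux n m : ℝ) ≤ 1 + Real.logb n m := by
    rw [← Real.logb_self_eq_one hn', ← Real.logb_mul (by positivity) (by positivity),
      Real.le_logb_iff_rpow_le hn' (by positivity), Real.rpow_natCast]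
    exact_mod_cast pow_clogAux_le hn hm
  have := Real.logb_nonneg hn' hm'
  rw [numVars]
  push_cast
  linarith

/-- Each of the `k` levels has `numVars n m + 1` arguments, the block `y` and the switch `z`, all of
them ranging over `U`. The bound uses `n³ + 1 ≤ n⁴`. -/
theorem size_le {n m : ℕ} (hn : 2 ≤ n) (hm : 1 ≤ m) (k : ℕ) :
    ((n * n * n + 1) ^ (numVars n m + 1)) ^ k ≤ (n ^ 44 * m ^ 8) ^ k := by
  have h₁ : n * n * n + 1 ≤ n ^ 4 := by
    have : 2 * (n * n * n) ≤ n * (n * n * n) := Nat.mul_le_mul_right _ hn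
    have h₂ : 1 ≤ n * n * n := Nat.mul_pos (Nat.mul_pos (by omega) (by omega)) (by omega)
    calc n * n * n + 1 ≤ n * (n * n * n) := by omega
      _ = n ^ 4 := by ring
  refine Nat.pow_le_pow_left ?_ k
  calc (n * n * n + 1) ^ (numVars n m + 1) ≤ (n ^ 4) ^ (numVars n m + 1) :=
        Nat.pow_le_pow_left h₁ _
    _ = (n ^ numVars n m * n) ^ 4 := by ring
    _ ≤ (n ^ 10 * m ^ 2 * n) ^ 4 :=
        Nat.pow_le_pow_left (Nat.mul_le_mul_right _ (pow_numVars_le hn hm)) 4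
    _ = n ^ 44 * m ^ 8 := by ring

end

end UnmixedPIT

/-! ### The main theorem -/

open UnmixedPIT
theorem mainTheorem3 :
    ∃ (alg test : Prog) (A : ℕ) (N T : ℕ → ℕ),
      ∀ (F : Type*) [Field F] (n k s : ℕ), 2 ≤ n → 1 ≤ k → 2 ≤ s →
      ∀ us : List F, us.Nodup → us.length = (n * s) ^ N k →
      ∃ (q : ℕ) (L : Fin n → MvPolynomial (Fin q) F) (c : Fin (n + 1) → F) (U : Finset F)
        (pts : List (Fin n → F)) (t : ℕ),
        -- the mapping `L` is a generator for sparse polynomials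
        IsGenerator L (sparseLowDegree F n (s ^ (5 * k ^ 2 + 2))) ∧
        (∀ i j, (L i).degreeOf j ≤ n - 1) ∧
        (q : ℝ) ≤ A * (1 + Real.logb n (s ^ (5 * k ^ 2 + 2))) ∧
        Function.Injective c ∧
        U.card = n ^ 3 + 1 ∧
        -- the algorithm outputs the set, in polynomial time
        Runs (noBox F) alg (Value.input n k s us) (Value.ofList (pts.map Value.ofPoint)) t ∧
        t ≤ (n * s) ^ T k ∧
        {a | a ∈ pts} = outputSet L c U k ∧
        -- the set is a small hitting set
        IsHittingSet (outputSet L c U k) (lowDegreeUnmixed F n k s) ∧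
        (outputSet L c U k).ncard ≤ n ^ (A * k) * s ^ (A * k ^ 3) ∧
        -- the black-box identity test
        ∀ P ∈ lowDegreeUnmixed F n k s, ∃ (v : Value F) (t' : ℕ),
          Runs (blackBox P) test (Value.input n k s us) v t' ∧ t' ≤ (n * s) ^ T k ∧
          (v ≠ .nil ↔ P = 0) := by
  classical
  obtain ⟨Ta, hTa⟩ := algP.exists_bound_le_pow
  obtain ⟨Tt, hTt⟩ := testP.exists_bound_le_pow
  -- The constant `56` covers the factor `10` for `q`, the exponent `44 * k` of `n`, and `8 * k * (5
  -- * k ^ 2 + 2) ≤ (40 + 16) * k ^ 3` for `s`. The list needs `n ^ 5 * m` elements, hence `5 + (5 *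
  -- k ^ 2 + 2)`. The exponent of the time is the exponent of `B` times a common bound for the
  -- exponents of the two programs.
  refine ⟨algP, testP, 56, fun k => 5 * k ^ 2 + 7,
    fun k => (44 * k + 8 * k * (5 * k ^ 2 + 2)) * (Ta + Tt), ?_⟩
  intro F _ n k s hn hk hs us hus hlen
  replace hlen : us.length = (n * s) ^ (5 * k ^ 2 + 7) := hlen
  set m := s ^ (5 * k ^ 2 + 2) with hm
  set b := 44 * k + 8 * k * (5 * k ^ 2 + 2) with hb
  set B := (n * s) ^ b with hB
  have hm1 : 1 ≤ m := Nat.one_le_pow _ _ (by omega)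
  have hm2 : 2 ≤ m := hs.trans (Nat.le_self_pow (by omega) s)
  have hns : 2 ≤ n * s := le_trans (by norm_num) (Nat.mul_le_mul hn hs)
  have hnns : n ≤ n * s := Nat.le_mul_of_pos_right _ (by omega)
  have hsns : s ≤ n * s := Nat.le_mul_of_pos_left _ (by omega)
  have hB2 : 2 ≤ B := hns.trans (Nat.le_self_pow (by omega) _)
  have hsize : ((n * n * n + 1) ^ (numVars n m + 1)) ^ k ≤
      n ^ (44 * k) * s ^ (8 * k * (5 * k ^ 2 + 2)) := by
    refine (size_le hn hm1 k).trans (le_of_eq ?_)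
    rw [hm]
    ring
  have hsizeB : ((n * n * n + 1) ^ (numVars n m + 1)) ^ k ≤ B := by
    refine hsize.trans ?_
    rw [hB, hb, pow_add]
    exact Nat.mul_le_mul (Nat.pow_le_pow_left hnns _) (Nat.pow_le_pow_left hsns _)
  have hY : n * n * n * (n * n * m) ≤ us.length := by
    rw [hlen, show 5 * k ^ 2 + 7 = 5 + (5 * k ^ 2 + 2) by ring, pow_add]
    calc n * n * n * (n * n * m) = n ^ 5 * m := by ring
      _ ≤ _ := Nat.mul_le_mul (Nat.pow_le_pow_left hnns _) (Nat.pow_le_pow_left hsns _)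
  have hlen' : n * n * n + 1 ≤ us.length := by
    have : 2 * 2 * 1 ≤ n * n * m := Nat.mul_le_mul (Nat.mul_le_mul hn hn) hm1
    have h₁ : 1 ≤ n * n * n := Nat.mul_pos (Nat.mul_pos (by omega) (by omega)) (by omega)
    have := Nat.mul_le_mul_left (n * n * n) this
    omega
  have hn3 : n ≤ n * n * n := by nlinarith
  set c : Fin (n + 1) → F := fun j => us[(j : ℕ)]'(by omega) with hcdef
  have hc : Function.Injective c := fun i j hij => Fin.ext ((hus.getElem_inj_iff).1 hij)
  have hcus : ∀ j : Fin (n + 1), us[(j : ℕ)]? = some (c j) := fun j =>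
    List.getElem?_eq_getElem (by omega)
  have hslen : (sampleList n us).length = n * n * n + 1 := by simp [sampleList, hlen']
  have hU : (sampleList n us).toFinset.card = n * n * n + 1 := by
    rw [List.toFinset_card_of_nodup, hslen]
    exact List.nodup_reverse.2 (hus.sublist (List.take_sublist _ _))
  have hout := mem_outputList n k m us c
  have hptslen : (outputList n k m us c).length =
      ((n * n * n + 1) ^ (numVars n m + 1)) ^ k := by rw [length_outputList, hslen]
  -- Listing the points makes no query, so the same run serves without a black box and inside the
  -- test.
  have halg : ∀ box, RunsIn box B algP (.input n k s us)
      (.ofList ((outputList n k m us c).map .ofPoint)) := fun box =>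
    runsIn_algP hn hk hs (by rw [hm, pow_two]) hY hc hcus hsizeB
  have hgen := isGenerator_sparseGenerator hn hm1 hus hY
  have hhit : IsHittingSet (outputSet (sparseGenerator n m us) c (sampleList n us).toFinset k)
      (lowDegreeUnmixed F n k s) :=
    isHittingSet_outputSet (fun i p hp => aeval_map_generator_ne_zero hm2 hgen i hp)
      (degreeOf_sparseGenerator_le m us) hc (by rw [hU]; nlinarith)
  have htime : ∀ t T : ℕ, t ≤ B ^ T → T ≤ Ta + Tt → t ≤ (n * s) ^ (b * (Ta + Tt)) := by
    intro t T ht hT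
    rw [pow_mul]
    exact ht.trans (Nat.pow_le_pow_right (by omega) hT)
  obtain ⟨t, ht, hrun⟩ := halg (noBox F)
  refine ⟨numVars n m, sparseGenerator n m us, c, (sampleList n us).toFinset,
    outputList n k m us c, t, hgen, degreeOf_sparseGenerator_le m us, ?_, hc, ?_, hrun,
    htime _ _ (ht.trans (hTa B hB2)) (by omega), hout, hhit, ?_, ?_⟩
  · have h₁ := numVars_le hn hm1
    have h₂ : 0 ≤ Real.logb n m := Real.logb_nonneg (by exact_mod_cast hn) (by exact_mod_cast hm1)
    rw [hm, Nat.cast_pow] at h₂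
    rw [hm, Nat.cast_pow] at h₁
    rw [← hm] at h₁
    push_cast
    linarith
  · rw [hU]
    ring
  · rw [← hout]
    calc _ = ((outputList n k m us c).toFinset : Set (Fin n → F)).ncard := by
            rw [List.coe_toFinset]
      _ ≤ (outputList n k m us c).length := by
            rw [Set.ncard_coe_finset]
            exact List.toFinset_card_le _
      _ ≤ n ^ (44 * k) * s ^ (8 * k * (5 * k ^ 2 + 2)) := hptslen ▸ hsize
      _ ≤ n ^ (56 * k) * s ^ (56 * k ^ 3) := by
            refine Nat.mul_le_mul (Nat.pow_le_pow_right (by omega) (by omega))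
              (Nat.pow_le_pow_right (by omega) ?_)
            have : k * 1 ≤ k * k ^ 2 := Nat.mul_le_mul_left _ (Nat.one_le_pow _ _ hk)
            calc 8 * k * (5 * k ^ 2 + 2) = 40 * k ^ 3 + 16 * (k * 1) := by ring
              _ ≤ 40 * k ^ 3 + 16 * (k * k ^ 2) := by omega
              _ = 56 * k ^ 3 := by ring
  · intro P hP
    obtain ⟨v, ⟨t', ht', hrun'⟩, hv⟩ := runsIn_testP (halg (blackBox P)) (hptslen ▸ hsizeB)
    refine ⟨v, t', hrun', htime _ _ (ht'.trans (hTt B hB2)) (by omega), hv.trans ⟨fun h => ?_, ?_⟩⟩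
    · by_contra hP0
      obtain ⟨a, ha, hne⟩ := hhit P hP hP0
      rw [← hout] at ha
      exact hne (h a ha)
    · rintro rfl a _
      exact map_zero _
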